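/- Let $d\ge 1$ be an integer, let $\alpha>d$, and let $(\xi(z):z\in\mathbb Z^d)$ be independent, identically Pareto-distributed random variables with parameter $\alpha$, i.e. $\operatorname{Prob}(\xi(z)<x)=1-x^{-\alpha}$ for $x\ge 1$. Let $|z|$ denote the $\ell^1$-norm of $z\in\mathbb Z^d$, let $N(z)$ be the number of nearest-neighbour paths in $\mathbb Z^d$ of length $|z|$ that start at the origin and pass through $z$, and let $\eta(z)=\log N(z)$. For $t>0$ put $$\Phi_t(z)=\Big[\xi(z)-\frac{|z|}{t}\log \xi(z)+\frac{\eta(z)}{t}\Big]\mathbf 1\{t\,\xi(z)\ge |z|\},\qquad z\in\mathbb Z^d .$$ Let $Z_t^{(1)},Z_t^{(2)},Z_t^{(3)}$ be distinct first three maximizers of $\Phi_t$, i.e. $\Phi_t(Z_t^{(1)})=\max_{z\in\mathbb Z^d}\Phi_t(z)$, $\Phi_t(Z_t^{(2)})=\max_{z\ne Z_t^{(1)}}\Phi_t(z)$ with $Z_t^{(2)}\neq Z_t^{(1)}$, and $\Phi_t(Z_t^{(3)})=\max_{z\notin\{ Z_t^{(1)},Z_t^{(2)}\}}\Phi_t(z)$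 with $Z_t^{(3)}\notin\{Z_t^{(1)},Z_t^{(2)}\}$. Let $q=\frac{d}{\alpha-d}$, fix $\beta>1+\frac1{\alpha-d}$, and let $$a_t=\Big(\frac{t}{\log t}\Big)^{q},\qquad \lambda_t=(\log t)^{-\beta}.$$ Then, almost surely, such maximizers exist for every $t>0$, and there is a (random) $t_0$ such that for all $t\ge t_0$ and every choice of the maximizers $$\Phi_t\big(Z_t^{(1)}\big)-\Phi_t\big(Z_t^{(3)}\big)\;\ge\; a_t\lambda_t .$$ -/

import Mathlib

open MeasureTheory ProbabilityTheory Filter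

noncomputable section

namespace ParabolicAnderson

/-- The `ℓ¹`-norm `|z|` of a lattice point `z ∈ ℤ^d`. -/
def l1 {d : ℕ} (z : Fin d → ℤ) : ℕ := ∑ i, (z i).natAbs

/-- The nearest-neighbour paths `p 0, p 1, …, p n` of length `n` in `ℤ^d` that start at the origin
and pass through `z`. -/
def paths {d : ℕ} (n : ℕ) (z : Fin d → ℤ) : Set (Fin (n + 1) → Fin d → ℤ) :=
  {p | p 0 = 0 ∧ (∀ i : Fin n, l1 (p i.succ - p i.castSucc) = 1) ∧ ∃ i, p i = z}

/-- The number `N(n, z)` of paths of length `n` starting at the origin and passing through `z`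
(the set of such paths is finite, see `paths_finite`). -/
def pathCount {d : ℕ} (n : ℕ) (z : Fin d → ℤ) : ℕ := (paths n z).ncard

/-- `η(z) = log N(|z|, z)`. -/
def eta {d : ℕ} (z : Fin d → ℤ) : ℝ := Real.log (pathCount (l1 z) z)

open Classical in
/-- The functional
`Φ_t(z) = [ξ(z) - (|z|/t) log ξ(z) + η(z)/t] 1{t ξ(z) ≥ |z|}` of a potential `ξ : ℤ^d → ℝ`. -/
def Phi {d : ℕ} (ξ : (Fin d → ℤ) → ℝ) (t : ℝ) (z : Fin d → ℤ) : ℝ :=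
  if (l1 z : ℝ) ≤ t * ξ z then
    ξ z - (l1 z : ℝ) / t * Real.log (ξ z) + eta z / t
  else 0

/-- `z₁`, `z₂`, `z₃` are (distinct) first, second and third maximizers of `f`: `z₁` maximizes `f`,
`z₂` maximizes `f` over the complement of `{z₁}`, and `z₃` maximizes `f` over the complement
of `{z₁, z₂}`. -/
structure IsTopThree {X : Type*} (f : X → ℝ) (z₁ z₂ z₃ : X) : Prop where
  max₁ : ∀ z, f z ≤ f z₁
  mem₂ : z₂ ≠ z₁
  max₂ : ∀ z, z ≠ z₁ → f z ≤ f z₂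
  mem₃ : z₃ ≠ z₁ ∧ z₃ ≠ z₂
  max₃ : ∀ z, z ≠ z₁ → z ≠ z₂ → f z ≤ f z₃

/-- The scale `a_t = (t / log t)^q` with `q = d / (α - d)`. -/
def aScale (d : ℕ) (α t : ℝ) : ℝ := (t / Real.log t) ^ ((d : ℝ) / (α - d))

/-- The scale `λ_t = (log t)^(-β)`. -/
def lambdaScale (β t : ℝ) : ℝ := Real.log t ^ (-β)

lemma natAbs_le_l1 {d : ℕ} (z : Fin d → ℤ) (i : Fin d) : (z i).natAbs ≤ l1 z :=
  Finset.single_le_sum (f := fun i => (z i).natAbs) (fun _ _ => Nat.zero_le _) (Finset.mem_univ i)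

lemma paths_finite {d : ℕ} (n : ℕ) (z : Fin d → ℤ) : (paths n z).Finite := by
  have hfin : (Set.Icc (fun _ _ => -(n : ℤ)) (fun _ _ => (n : ℤ)) :
      Set (Fin (n + 1) → Fin d → ℤ)).Finite := Set.finite_Icc _ _
  refine hfin.subset fun p hp => ?_
  obtain ⟨h0, hstep, -⟩ := hp
  have key : ∀ (i : Fin (n + 1)) (j : Fin d), |p i j| ≤ (i : ℕ) := by
    intro i
    induction i using Fin.induction with
    | zero => intro j; simp [h0]
    | succ i ih =>
      intro j
      have h1 := natAbs_le_l1 (p i.succ - p i.castSucc) j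
      rw [hstep i] at h1
      have h2 := ih j
      simp only [Pi.sub_apply, Fin.val_castSucc, Fin.val_succ] at h1 h2 ⊢
      push_cast
      rw [abs_le] at h2 ⊢
      omega
  rw [Set.mem_Icc, Pi.le_def, Pi.le_def]
  constructor <;> intro i <;> rw [Pi.le_def] <;> intro j <;>
    · have h1 := abs_le.1 (key i j)
      have h2 := i.is_lt
      omega

end ParabolicAnderson

end

noncomputable section

namespace ParabolicAnderson

/-! Write g = α - d, q = d/g, L = log T, τ = T/L and a = a_T, so that a^g = τ^d. It suffices to
bound the gap below by aμ for all t in [T, 2T], where T = 2^n and μ = 2^q L^(-β). Outside an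
exceptional event of probability O(L^(-1-ε)), which is summable in n, three things hold with κ =
L^(-ε) and K = L^((1+ε)/g).

A site near the origin has potential at least 2κa, so max Φ_t ≥ κa. The potential lies below an
affine envelope in |z|, so sites with Φ_t ≥ κa/4 lie within distance Kaτ. At no time of a grid of
mesh Tμ/(2qK) do three sites have active branch values in a common window of length 4aμ at a
relevant level. Since these values move by at most aμ within one mesh step (`abs_branch_sub_le`),
the last property excludes a small gap at every time (`gap_le`).

The third event gives the exponent. Where it matters, a branch has slope at least 1/2 in ξ, so a
window of values is a short interval of potentials. Independence bounds the probability of three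
hits by the cube of the expected number of hits, of order μ^3 per level. There are about 1/μ levels
and K/μ grid times, leaving Kμ up to powers of κ (`exists_measure_clusterEvent_le`); this is
summable exactly when β > 1 + 1/g, for ε small. Pairs instead of triples would leave no power of μ,
hence the third maximizer. -/

/-! ### Crude bounds on path counts -/

lemma pathCount_le {d : ℕ} (n : ℕ) (z : Fin d → ℤ) : pathCount n z ≤ (3 ^ d) ^ n := by
  classical
  have hcard : ((Finset.Icc (fun _ _ => -1) (fun _ _ => 1) :
      Finset (Fin n → Fin d → ℤ)) : Set (Fin n → Fin d → ℤ)).ncard = (3 ^ d) ^ n := by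
    rw [Set.ncard_coe_finset, Pi.card_Icc]
    simp [Pi.card_Icc]
  rw [← hcard, pathCount]
  refine Set.ncard_le_ncard_of_injOn (fun p i => p i.succ - p i.castSucc) ?_ ?_
    (Finset.finite_toSet _)
  · rintro p ⟨-, hp, -⟩
    simp only [Finset.coe_Icc, Set.mem_Icc, Pi.le_def]
    constructor <;> intro i j <;>
    · have h1 := natAbs_le_l1 (p i.succ - p i.castSucc) j
      rw [hp i] at h1
      simp only [Pi.sub_apply] at h1 ⊢
      omega
  · rintro p ⟨hp, -, -⟩ p' ⟨hp', -, -⟩ h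
    funext i
    induction i using Fin.induction with
    | zero => rw [hp, hp']
    | succ i ih =>
      have := congrFun h i
      simp only [ih] at this
      exact sub_left_injective this

lemma eta_nonneg {d : ℕ} (z : Fin d → ℤ) : 0 ≤ eta z := Real.log_natCast_nonneg _

lemma eta_le {d : ℕ} (z : Fin d → ℤ) : eta z ≤ d * Real.log 3 * l1 z := by
  -- `Real.log 0 = 0` disposes of a zero count, so positivity need not be proved.
  rcases Nat.eq_zero_or_pos (pathCount (l1 z) z) with h | h
  · have : 0 ≤ Real.log 3 := Real.log_nonneg (by norm_num)
    rw [eta, h]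
    simp only [Nat.cast_zero, Real.log_zero]
    positivity
  · have h1 : (pathCount (l1 z) z : ℝ) ≤ (3 ^ d) ^ l1 z := by
      exact_mod_cast pathCount_le (l1 z) z
    calc eta z ≤ Real.log ((3 ^ d) ^ l1 z) := Real.log_le_log (by exact_mod_cast h) h1
      _ = d * Real.log 3 * l1 z := by rw [Real.log_pow, Real.log_pow]; ring

/-! ### Convexity and lattice sums -/

/-- The graph of `x ↦ x ^ (-γ)` lies above its tangents. -/
lemma rpow_neg_tangent_le {γ x y : ℝ} (hγ : 0 ≤ γ) (hx : 0 < x) (hy : 0 < y) :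
    x ^ (-γ) - γ * x ^ (-γ - 1) * (y - x) ≤ y ^ (-γ) := by
  have h1 : y = x * (y / x) := by field_simp
  have hs : 0 < y / x := by positivity
  have h2 : y ^ (-γ) = x ^ (-γ) * (y / x) ^ (-γ) := by
    conv_lhs => rw [h1]
    exact Real.mul_rpow hx.le hs.le
  have h3 : 1 - γ * (y / x - 1) ≤ (y / x) ^ (-γ) := by
    rw [Real.rpow_def_of_pos hs]
    have := Real.add_one_le_exp (Real.log (y / x) * -γ)
    have := mul_le_mul_of_nonneg_left (Real.log_le_sub_one_of_pos hs) hγ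
    linarith
  have h4 : x ^ (-γ) - γ * x ^ (-γ - 1) * (y - x) = x ^ (-γ) * (1 - γ * (y / x - 1)) := by
    rw [Real.rpow_sub_one hx.ne']
    field_simp
  rw [h2, h4]
  exact mul_le_mul_of_nonneg_left h3 (by positivity)

/-- Comparison with the integral of (1 + εx)^(-p). The integral over [0, N] is kept exactly so that
the induction closes; each increment is the tangent inequality at the right endpoint, for the
exponent p - 1. -/
lemma sum_range_one_add_mul_rpow_le {p ε : ℝ} (hp : 1 < p) (hε : 0 < ε) (N : ℕ) :
    ∑ k ∈ Finset.range (N + 1), (1 + ε * k) ^ (-p) ≤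
      1 + (1 - (1 + ε * N) ^ (-(p - 1))) / (ε * (p - 1)) := by
  have hp' : 0 < p - 1 := by linarith
  induction N with
  | zero => simp
  | succ N ih =>
    rw [Finset.sum_range_succ]
    have hx : 0 < 1 + ε * ((N + 1 : ℕ) : ℝ) := by positivity
    have hy : 0 < 1 + ε * (N : ℝ) := by positivity
    have h := rpow_neg_tangent_le hp'.le hx hy
    rw [show -(p - 1) - 1 = -p by ring] at h
    have h2 : (1 + ε * ((N + 1 : ℕ) : ℝ)) ^ (-p) ≤
        ((1 + ε * (N : ℝ)) ^ (-(p - 1)) - (1 + ε * ((N + 1 : ℕ) : ℝ)) ^ (-(p - 1)))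
          / (ε * (p - 1)) := by
      rw [le_div_iff₀ (by positivity)]
      push_cast at h ⊢
      linarith
    have h3 : (1 - (1 + ε * ((N + 1 : ℕ) : ℝ)) ^ (-(p - 1))) / (ε * (p - 1)) =
        (1 - (1 + ε * (N : ℝ)) ^ (-(p - 1))) / (ε * (p - 1)) +
        ((1 + ε * (N : ℝ)) ^ (-(p - 1)) - (1 + ε * ((N + 1 : ℕ) : ℝ)) ^ (-(p - 1)))
          / (ε * (p - 1)) := by ring
    linarith

lemma sum_Icc_one_add_mul_rpow_le {p ε : ℝ} (hp : 1 < p) (hε : 0 < ε) (hε1 : ε ≤ 1) (N : ℕ) :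
    ∑ k ∈ Finset.Icc (-(N : ℤ)) N, (1 + ε * k.natAbs) ^ (-p) ≤
      2 * (1 + 1 / (p - 1)) / ε := by
  classical
  have hp' : 0 < p - 1 := by linarith
  set f : ℤ → ℝ := fun k => (1 + ε * k.natAbs) ^ (-p) with hf
  have hf0 : ∀ k, 0 ≤ f k := fun k => by simp only [hf]; positivity
  set s := (Finset.range (N + 1)).image (fun k : ℕ => (k : ℤ)) with hs
  set s' := (Finset.range (N + 1)).image (fun k : ℕ => -(k : ℤ)) with hs'
  have hsub : Finset.Icc (-(N : ℤ)) N ⊆ s ∪ s' := by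
    intro k hk
    rw [Finset.mem_Icc] at hk
    simp only [hs, hs', Finset.mem_union, Finset.mem_image, Finset.mem_range]
    rcases le_total 0 k with h | h
    · exact Or.inl ⟨k.natAbs, by omega, by omega⟩
    · exact Or.inr ⟨k.natAbs, by omega, by omega⟩
  have h1 : ∑ k ∈ s, f k = ∑ k ∈ Finset.range (N + 1), (1 + ε * k) ^ (-p) := by
    rw [hs, Finset.sum_image (fun a _ b _ h => by simpa using h)]
    simp [hf]
  have h2 : ∑ k ∈ s', f k = ∑ k ∈ Finset.range (N + 1), (1 + ε * k) ^ (-p) := by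
    rw [hs', Finset.sum_image (fun a _ b _ h => by simpa using h)]
    simp [hf]
  have h3 : ∑ k ∈ Finset.range (N + 1), (1 + ε * k) ^ (-p) ≤ (1 + 1 / (p - 1)) / ε := by
    refine (sum_range_one_add_mul_rpow_le hp hε N).trans ?_
    have h4 : (1 - (1 + ε * N) ^ (-(p - 1))) / (ε * (p - 1)) ≤ 1 / (ε * (p - 1)) := by
      gcongr
      have : 0 ≤ (1 + ε * N) ^ (-(p - 1)) := by positivity
      linarith
    have h5 : (1 + 1 / (p - 1)) / ε = 1 / ε + 1 / (ε * (p - 1)) := by field_simp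
    have h6 : 1 ≤ 1 / ε := by rwa [le_div_iff₀ hε, one_mul]
    linarith
  calc ∑ k ∈ Finset.Icc (-(N : ℤ)) N, f k ≤ ∑ k ∈ s ∪ s', f k :=
        Finset.sum_le_sum_of_subset_of_nonneg hsub (fun _ _ _ => hf0 _)
    _ ≤ ∑ k ∈ s, f k + ∑ k ∈ s', f k := by
        rw [← Finset.sum_union_inter]
        linarith [Finset.sum_nonneg (s := s ∩ s') (fun k _ => hf0 k)]
    _ ≤ _ := by rw [h1, h2, mul_div_assoc]; linarith

/-- As |z| dominates every |z_i|, the summand is at most a product over coordinates with exponent p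
= γ/d > 1. The sum then factorises into d one-dimensional sums, each O(R). -/
lemma exists_sum_one_add_l1_div_rpow_le {d : ℕ} (hd : 1 ≤ d) {γ : ℝ} (hγ : (d : ℝ) < γ) :
    ∃ C : ℝ, 0 < C ∧ ∀ R : ℝ, 1 ≤ R →
      ∑' z : Fin d → ℤ, ENNReal.ofReal ((1 + l1 z / R) ^ (-γ)) ≤ ENNReal.ofReal (C * R ^ d) := by
  classical
  have hd0 : (0 : ℝ) < d := by exact_mod_cast hd
  set p := γ / d with hpdef
  have hp : 1 < p := by rwa [hpdef, one_lt_div hd0]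
  have hp' : 0 < p - 1 := by linarith
  have hpd : p * d = γ := by rw [hpdef]; field_simp
  refine ⟨(2 * (1 + 1 / (p - 1))) ^ d, by positivity, fun R hR => ?_⟩
  have hR0 : 0 < R := by linarith
  rw [ENNReal.tsum_eq_iSup_sum]
  refine iSup_le fun s => ?_
  rw [← ENNReal.ofReal_sum_of_nonneg (fun z _ => by positivity)]
  refine ENNReal.ofReal_le_ofReal ?_
  set N := s.sup l1 with hN
  have hsub : s ⊆ Fintype.piFinset (fun _ : Fin d => Finset.Icc (-(N : ℤ)) N) := by
    intro z hz
    rw [Fintype.mem_piFinset]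
    intro i
    have h1 := natAbs_le_l1 z i
    have h2 : l1 z ≤ N := Finset.le_sup hz
    rw [Finset.mem_Icc]
    omega
  have hterm : ∀ z : Fin d → ℤ,
      (1 + l1 z / R) ^ (-γ) ≤ ∏ i, (1 + 1 / R * (z i).natAbs) ^ (-p) := by
    intro z
    have h1 : ∏ i : Fin d, (1 + l1 z / R) ^ (-p) = (1 + l1 z / R) ^ (-γ) := by
      rw [Finset.prod_const, Finset.card_univ, Fintype.card_fin, ← Real.rpow_natCast,
        ← Real.rpow_mul (by positivity)]
      congr 1
      linarith
    rw [← h1]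
    refine Finset.prod_le_prod (fun _ _ => by positivity) fun i _ => ?_
    refine Real.rpow_le_rpow_of_nonpos (by positivity) ?_ (by linarith)
    have : ((z i).natAbs : ℝ) ≤ l1 z := by exact_mod_cast natAbs_le_l1 z i
    rw [one_div, inv_mul_eq_div]
    gcongr
  calc ∑ z ∈ s, (1 + l1 z / R) ^ (-γ)
      ≤ ∑ z ∈ Fintype.piFinset (fun _ : Fin d => Finset.Icc (-(N : ℤ)) N),
          (1 + l1 z / R) ^ (-γ) :=
        Finset.sum_le_sum_of_subset_of_nonneg hsub (fun _ _ _ => by positivity)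
    _ ≤ ∑ z ∈ Fintype.piFinset (fun _ : Fin d => Finset.Icc (-(N : ℤ)) N),
          ∏ i, (1 + 1 / R * (z i).natAbs) ^ (-p) := Finset.sum_le_sum fun z _ => hterm z
    _ = ∏ _i : Fin d, ∑ k ∈ Finset.Icc (-(N : ℤ)) N, (1 + 1 / R * k.natAbs) ^ (-p) :=
        (Finset.prod_univ_sum (fun _ : Fin d => Finset.Icc (-(N : ℤ)) N)
          (fun _ k => (1 + 1 / R * (k.natAbs : ℝ)) ^ (-p))).symm
    _ ≤ ∏ _i : Fin d, (2 * (1 + 1 / (p - 1)) * R) := by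
        refine Finset.prod_le_prod (fun _ _ => Finset.sum_nonneg fun _ _ => by positivity)
          fun _ _ => ?_
        have := sum_Icc_one_add_mul_rpow_le hp (ε := 1 / R) (by positivity)
          (by rw [div_le_one hR0]; exact hR) N
        rwa [div_div_eq_mul_div, div_one] at this
    _ = _ := by rw [Finset.prod_const, Finset.card_univ, Fintype.card_fin, mul_pow]

/-! ### Φ_t as a function of the potential at one site -/

/-- The active branch `x ↦ x - (m / t) log x + e / t` of the functional `Φ_t`, with
`m = |z|` and `e = η(z)`. -/
def branch (t m e x : ℝ) : ℝ := x - m / t * Real.log x + e / t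

/-- A value at least u forces x ≥ u/(1 + D), hence log x - D ≥ (log u)/2 for large u: the entropy e
cannot offset the logarithmic cost, and x must exceed u by a term linear in m. The second conclusion
makes the slope 1 - m/(tx) at least 1/2. -/
lemma le_of_le_branch {D t m e x u : ℝ} (hD : 0 ≤ D) (ht : 0 < t) (hm : 0 ≤ m)
    (he : e ≤ D * m) (hx : 1 ≤ x) (hmx : m ≤ t * x) (hu : 0 < u) (hu4 : 4 ≤ Real.log u)
    (huD : 2 * (D + Real.log (1 + D)) ≤ Real.log u) (hux : u ≤ branch t m e x) :
    u + m * Real.log u / (2 * t) ≤ x ∧ 2 * m ≤ t * x := by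
  have hx0 : 0 < x := by linarith
  have hmt : m / t ≤ x := by rw [div_le_iff₀ ht]; linarith
  have hmt0 : 0 ≤ m / t := by positivity
  have het : e / t ≤ D * (m / t) := by rw [← mul_div_assoc]; gcongr
  have hlogx : 0 ≤ Real.log x := Real.log_nonneg hx
  rw [branch] at hux
  have h1 : u ≤ (1 + D) * x := by
    have := mul_le_mul_of_nonneg_left hmt hD
    have := mul_nonneg hmt0 hlogx
    linarith
  have h2 : Real.log u ≤ Real.log (1 + D) + Real.log x := by
    rw [← Real.log_mul (by positivity) hx0.ne']
    exact Real.log_le_log hu h1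
  have h3 : Real.log u / 2 ≤ Real.log x - D := by linarith
  have h4 : u + m / t * (Real.log u / 2) ≤ x := by
    have := mul_le_mul_of_nonneg_left h3 hmt0
    linarith
  have h5 : m / t * 2 ≤ m / t * (Real.log u / 2) := by gcongr; linarith
  constructor
  · calc u + m * Real.log u / (2 * t) = u + m / t * (Real.log u / 2) := by field_simp
      _ ≤ x := h4
  · have h6 : m / t * 2 ≤ x := by linarith
    rw [div_mul_eq_mul_div, div_le_iff₀ ht] at h6
    linarith

lemma half_sub_le_branch_sub {t m e x y : ℝ} (ht : 0 < t) (hm : 0 ≤ m) (hx : 0 < x)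
    (hxy : x ≤ y) (hmx : 2 * m ≤ t * x) :
    (y - x) / 2 ≤ branch t m e y - branch t m e x := by
  have hy : 0 < y := by linarith
  have h1 : Real.log y - Real.log x ≤ (y - x) / x := by
    rw [← Real.log_div hy.ne' hx.ne', sub_div, div_self hx.ne']
    exact Real.log_le_sub_one_of_pos (by positivity)
  have h2 : m / t * (Real.log y - Real.log x) ≤ x / 2 * ((y - x) / x) := by
    have : m / t ≤ x / 2 := by rw [div_le_div_iff₀ ht two_pos]; linarith
    have h0 : 0 ≤ (y - x) / x := div_nonneg (by linarith) hx.le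
    calc m / t * (Real.log y - Real.log x) ≤ m / t * ((y - x) / x) := by gcongr
      _ ≤ _ := by gcongr
  have h3 : x / 2 * ((y - x) / x) = (y - x) / 2 := by field_simp
  simp only [branch]
  linarith

lemma branch_mono {t m e x y : ℝ} (ht : 0 < t) (hm : 0 ≤ m) (hx : 0 < x)
    (hxy : x ≤ y) (hmx : m ≤ t * x) : branch t m e x ≤ branch t m e y := by
  have hy : 0 < y := by linarith
  have h1 : Real.log y - Real.log x ≤ (y - x) / x := by
    rw [← Real.log_div hy.ne' hx.ne', sub_div, div_self hx.ne']
    exact Real.log_le_sub_one_of_pos (by positivity)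
  have h2 : m / t * (Real.log y - Real.log x) ≤ x * ((y - x) / x) := by
    have : m / t ≤ x := by rw [div_le_iff₀ ht]; linarith
    have h0 : 0 ≤ (y - x) / x := div_nonneg (by linarith) hx.le
    calc m / t * (Real.log y - Real.log x) ≤ m / t * ((y - x) / x) := by gcongr
      _ ≤ _ := by gcongr
  have h3 : x * ((y - x) / x) = y - x := by field_simp
  simp only [branch]
  linarith

/-- The values `x` of the potential for which the branch is active with values in `[u, v]`. -/
def window (t m e u v : ℝ) : Set ℝ :=
  {x | 1 ≤ x ∧ m ≤ t * x ∧ u ≤ branch t m e x ∧ branch t m e x ≤ v}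

/-- With slope at least 1/2, two points of the window differ by at most 2w. The lower bound on A,
growing with m, later makes the sum over sites converge. -/
lemma exists_window_subset_Ico {D t m e u w : ℝ} (hD : 0 ≤ D) (ht : 0 < t) (hm : 0 ≤ m)
    (he : e ≤ D * m) (hu : 0 < u) (hu4 : 4 ≤ Real.log u)
    (huD : 2 * (D + Real.log (1 + D)) ≤ Real.log u) (hw : 0 < w) :
    ∃ A B, u + m * Real.log u / (2 * t) ≤ A ∧ A ≤ B ∧ B - A ≤ 5 * w ∧
      window t m e u (u + w) ⊆ Set.Ico A B := by
  set l := u + m * Real.log u / (2 * t)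
  rcases (window t m e u (u + w)).eq_empty_or_nonempty with h | ⟨x₀, h1, h2, h3, h4⟩
  · exact ⟨l, l, le_rfl, le_rfl, by linarith, by simp [h]⟩
  · obtain ⟨h5, h6⟩ := le_of_le_branch hD ht hm he h1 h2 hu hu4 huD h3
    -- The margin 3w rather than 2w on the right makes the upper inequality strict.
    refine ⟨max l (x₀ - 2 * w), x₀ + 3 * w, le_max_left _ _, ?_, ?_, ?_⟩
    · exact max_le (by linarith) (by linarith)
    · linarith [le_max_right l (x₀ - 2 * w)]
    · rintro x ⟨g1, g2, g3, g4⟩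
      obtain ⟨g5, g6⟩ := le_of_le_branch hD ht hm he g1 g2 hu hu4 huD g3
      rcases le_total x x₀ with hx | hx
      · have := half_sub_le_branch_sub (e := e) ht hm (by linarith) hx g6
        exact ⟨max_le g5 (by linarith), by linarith⟩
      · have := half_sub_le_branch_sub (e := e) ht hm (by linarith) hx h6
        exact ⟨max_le g5 (by linarith), by linarith⟩

lemma Phi_eq_branch {d : ℕ} {ξ : (Fin d → ℤ) → ℝ} {t : ℝ} {z : Fin d → ℤ}
    (h : (l1 z : ℝ) ≤ t * ξ z) : Phi ξ t z = branch t (l1 z) (eta z) (ξ z) := by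
  rw [Phi, if_pos h, branch]

lemma le_mul_of_Phi_pos {d : ℕ} {ξ : (Fin d → ℤ) → ℝ} {t : ℝ} {z : Fin d → ℤ}
    (h : 0 < Phi ξ t z) : (l1 z : ℝ) ≤ t * ξ z := by
  by_contra hn
  rw [Phi, if_neg hn] at h
  exact h.false

/-! ### Existence of maximizers -/

lemma exists_isMaxOn_of_finite_range {X : Type*} {f : X → ℝ} (hf : (Set.range f).Finite)
    {s : Set X} (hs : s.Nonempty) : ∃ x ∈ s, ∀ y ∈ s, f y ≤ f x := by
  have h1 : (f '' s).Finite := hf.subset (Set.image_subset_range _ _)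
  obtain ⟨_, ⟨x, hx, rfl⟩, hm⟩ := Set.exists_max_image (f '' s) id h1 (hs.image f)
  exact ⟨x, hx, fun y hy => hm _ ⟨y, hy, rfl⟩⟩

lemma exists_isTopThree {X : Type*} [Infinite X] {f : X → ℝ} (hf : (Set.range f).Finite) :
    ∃ z₁ z₂ z₃, IsTopThree f z₁ z₂ z₃ := by
  obtain ⟨z₁, -, h1⟩ := exists_isMaxOn_of_finite_range hf (Set.univ_nonempty)
  obtain ⟨z₂, m2, h2⟩ := exists_isMaxOn_of_finite_range hf
    (Set.finite_singleton z₁).infinite_compl.nonempty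
  obtain ⟨z₃, m3, h3⟩ := exists_isMaxOn_of_finite_range hf
    (Set.toFinite {z₁, z₂}).infinite_compl.nonempty
  simp only [Set.mem_compl_iff, Set.mem_insert_iff, Set.mem_singleton_iff, not_or] at m2 m3 h2 h3
  exact ⟨z₁, z₂, z₃, fun z => h1 z trivial, m2, fun z hz => h2 z hz, m3,
    fun z hz hz' => h3 z ⟨hz, hz'⟩⟩

/-! ### Union bounds for independent Pareto fields -/

/-- Some three distinct sites `z` satisfy `ξ z ∈ S z`. -/
def tripleHit {X Ω : Type*} (ξ : X → Ω → ℝ) (S : X → Set ℝ) : Set Ω :=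
  {ω | ∃ x y z, x ≠ y ∧ x ≠ z ∧ y ≠ z ∧ ξ x ω ∈ S x ∧ ξ y ω ∈ S y ∧ ξ z ω ∈ S z}

/-- Union bound over distinct triples, where independence factorises the probability. Adding back
the coinciding triples turns the sum into a cube. -/
lemma measure_tripleHit_le {d : ℕ} {Ω : Type*} [MeasurableSpace Ω] {P : Measure Ω}
    {ξ : (Fin d → ℤ) → Ω → ℝ} (hind : iIndepFun ξ P) {S : (Fin d → ℤ) → Set ℝ}
    (hS : ∀ z, MeasurableSet (S z)) :
    P (tripleHit ξ S) ≤ (∑' z, P (ξ z ⁻¹' S z)) ^ 3 := by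
  classical
  have hsub : tripleHit ξ S ⊆ ⋃ x, ⋃ y, ⋃ z,
      {ω | x ≠ y ∧ x ≠ z ∧ y ≠ z ∧ ξ x ω ∈ S x ∧ ξ y ω ∈ S y ∧ ξ z ω ∈ S z} := by
    rintro ω ⟨x, y, z, hω⟩
    simp only [Set.mem_iUnion]
    exact ⟨x, y, z, hω⟩
  have hle : ∀ x y z, P {ω | x ≠ y ∧ x ≠ z ∧ y ≠ z ∧ ξ x ω ∈ S x ∧ ξ y ω ∈ S y ∧ ξ z ω ∈ S z} ≤
      P (ξ x ⁻¹' S x) * (P (ξ y ⁻¹' S y) * P (ξ z ⁻¹' S z)) := by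
    intro x y z
    by_cases hne : x ≠ y ∧ x ≠ z ∧ y ≠ z
    · have h1 := hind.measure_inter_preimage_eq_mul {x, y, z} (sets := S) (fun i _ => hS i)
      rw [Finset.prod_insert (by simp [hne.1, hne.2.1]), Finset.prod_insert (by simp [hne.2.2]),
        Finset.prod_singleton] at h1
      rw [← h1]
      refine measure_mono ?_
      rintro ω ⟨-, -, -, hx, hy, hz⟩
      simp [hx, hy, hz]
    · have h2 : {ω | x ≠ y ∧ x ≠ z ∧ y ≠ z ∧ ξ x ω ∈ S x ∧ ξ y ω ∈ S y ∧ ξ z ω ∈ S z} = ∅ := by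
        ext ω
        simp only [Set.mem_ofPred_eq, Set.mem_empty_iff_false, iff_false]
        tauto
      rw [h2, measure_empty]
      exact zero_le
  calc P (tripleHit ξ S)
      ≤ ∑' x, ∑' y, ∑' z, P (ξ x ⁻¹' S x) * (P (ξ y ⁻¹' S y) * P (ξ z ⁻¹' S z)) := by
        refine (measure_mono hsub).trans ((measure_iUnion_le _).trans ?_)
        refine ENNReal.tsum_le_tsum fun x => (measure_iUnion_le _).trans ?_
        refine ENNReal.tsum_le_tsum fun y => (measure_iUnion_le _).trans ?_
        exact ENNReal.tsum_le_tsum fun z => hle x y z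
    _ = _ := by
        simp only [ENNReal.tsum_mul_left, ENNReal.tsum_mul_right]
        ring

/-- An independent field of Pareto distributed random variables with parameter `α`. -/
structure IsParetoField {d : ℕ} {Ω : Type*} [MeasurableSpace Ω] (α : ℝ) (P : Measure Ω)
    (ξ : (Fin d → ℤ) → Ω → ℝ) : Prop where
  measurable : ∀ z, Measurable (ξ z)
  indep : iIndepFun ξ P
  real_lt : ∀ z, ∀ x : ℝ, 1 ≤ x → P.real {ω | ξ z ω < x} = 1 - x ^ (-α)

namespace IsParetoField

variable {d : ℕ} {Ω : Type*} [MeasurableSpace Ω] {α : ℝ} {P : Measure Ω} [IsProbabilityMeasure P]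
  {ξ : (Fin d → ℤ) → Ω → ℝ}

lemma measure_lt (h : IsParetoField α P ξ) (z : Fin d → ℤ) {x : ℝ} (hx : 1 ≤ x) :
    P {ω | ξ z ω < x} = ENNReal.ofReal (1 - x ^ (-α)) := by
  rw [← h.real_lt z x hx, ofReal_measureReal]

lemma measure_le (h : IsParetoField α P ξ) (z : Fin d → ℤ) {x : ℝ} (hx : 1 ≤ x) :
    P {ω | x ≤ ξ z ω} = ENNReal.ofReal (x ^ (-α)) := by
  have h1 : {ω | x ≤ ξ z ω} = {ω | ξ z ω < x}ᶜ := by ext; simp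
  have hm : MeasurableSet {ω | ξ z ω < x} := measurableSet_lt (h.measurable z) measurable_const
  rw [h1, ← ofReal_measureReal, probReal_compl_eq_one_sub hm, h.real_lt z x hx, sub_sub_cancel]

lemma measure_Ico_le (h : IsParetoField α P ξ) (hα : 0 ≤ α) (z : Fin d → ℤ) {A B : ℝ}
    (hA : 1 ≤ A) (hAB : A ≤ B) :
    P (ξ z ⁻¹' Set.Ico A B) ≤ ENNReal.ofReal (α * A ^ (-α - 1) * (B - A)) := by
  have hm : MeasurableSet {ω | ξ z ω < A} := measurableSet_lt (h.measurable z) measurable_const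
  have h1 : ξ z ⁻¹' Set.Ico A B = {ω | ξ z ω < B} \ {ω | ξ z ω < A} := by
    ext ω; simp [and_comm]
  have hsub : {ω | ξ z ω < A} ⊆ {ω | ξ z ω < B} := fun ω hω => lt_of_lt_of_le hω hAB
  have h2 : P.real (ξ z ⁻¹' Set.Ico A B) = (1 - B ^ (-α)) - (1 - A ^ (-α)) := by
    rw [h1, measureReal_sdiff hsub hm, h.real_lt z A hA,
      h.real_lt z B (hA.trans hAB)]
  rw [← ofReal_measureReal, h2]
  refine ENNReal.ofReal_le_ofReal ?_
  have := rpow_neg_tangent_le hα (by linarith : 0 < A) (by linarith : 0 < B)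
  linarith

lemma ae_one_le (h : IsParetoField α P ξ) : ∀ᵐ ω ∂P, ∀ z, 1 ≤ ξ z ω := by
  rw [ae_all_iff]
  intro z
  have h1 : P {ω | ξ z ω < 1} = 0 := by rw [h.measure_lt z le_rfl]; simp
  rw [ae_iff]
  simpa using h1

lemma measure_forall_lt_le (h : IsParetoField α P ξ) (hα : 0 ≤ α) (s : Finset (Fin d → ℤ))
    {x : ℝ} (hx : 1 ≤ x) :
    P {ω | ∀ z ∈ s, ξ z ω < x} ≤ ENNReal.ofReal (Real.exp (-(s.card * x ^ (-α)))) := by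
  have h1 : {ω | ∀ z ∈ s, ξ z ω < x} = ⋂ z ∈ s, ξ z ⁻¹' Set.Iio x := by ext; simp
  have hx1 : x ^ (-α) ≤ 1 := Real.rpow_le_one_of_one_le_of_nonpos hx (by linarith)
  rw [h1, h.indep.measure_inter_preimage_eq_mul s (fun _ _ => measurableSet_Iio)]
  have h2 : ∀ z, P (ξ z ⁻¹' Set.Iio x) = ENNReal.ofReal (1 - x ^ (-α)) :=
    fun z => h.measure_lt z hx
  simp only [h2, Finset.prod_const]
  rw [← ENNReal.ofReal_pow (by linarith)]
  refine ENNReal.ofReal_le_ofReal ?_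
  have h3 : Real.exp (-(s.card * x ^ (-α))) = Real.exp (-x ^ (-α)) ^ s.card := by
    rw [← Real.exp_nat_mul]; congr 1; ring
  rw [h3]
  refine pow_le_pow_left₀ (by linarith) ?_ _
  linarith [Real.add_one_le_exp (-x ^ (-α))]

lemma exists_measure_exists_ge_le (hd : 1 ≤ d) (hα : (d : ℝ) < α) :
    ∃ C : ℝ, 0 < C ∧ ∀ {Ω : Type*} [MeasurableSpace Ω] {P : Measure Ω} [IsProbabilityMeasure P]
      {ξ : (Fin d → ℤ) → Ω → ℝ}, IsParetoField α P ξ → ∀ b R : ℝ, 1 ≤ b → 1 ≤ R →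
      P {ω | ∃ z, b * (1 + l1 z / R) ≤ ξ z ω} ≤ ENNReal.ofReal (C * b ^ (-α) * R ^ d) := by
  obtain ⟨C, hC, hS⟩ := exists_sum_one_add_l1_div_rpow_le hd hα
  refine ⟨C, hC, fun {Ω} _ {P} _ {ξ} h b R hb hR => ?_⟩
  have hR0 : 0 < R := by linarith
  have h1 : {ω | ∃ z, b * (1 + l1 z / R) ≤ ξ z ω} = ⋃ z, {ω | b * (1 + l1 z / R) ≤ ξ z ω} := by
    ext; simp
  have h2 : ∀ z : Fin d → ℤ, P {ω | b * (1 + l1 z / R) ≤ ξ z ω} =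
      ENNReal.ofReal (b ^ (-α)) * ENNReal.ofReal ((1 + l1 z / R) ^ (-α)) := by
    intro z
    have h3 : 1 ≤ 1 + (l1 z : ℝ) / R := by
      have : (0 : ℝ) ≤ l1 z / R := by positivity
      linarith
    rw [h.measure_le z (one_le_mul_of_one_le_of_one_le hb h3),
      Real.mul_rpow (by linarith) (by linarith), ENNReal.ofReal_mul (by positivity)]
  calc P {ω | ∃ z, b * (1 + l1 z / R) ≤ ξ z ω}
      ≤ ∑' z, P {ω | b * (1 + l1 z / R) ≤ ξ z ω} := by rw [h1]; exact measure_iUnion_le _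
    _ = ENNReal.ofReal (b ^ (-α)) * ∑' z : Fin d → ℤ,
          ENNReal.ofReal ((1 + l1 z / R) ^ (-α)) := by
        rw [← ENNReal.tsum_mul_left]; exact tsum_congr h2
    _ ≤ ENNReal.ofReal (b ^ (-α)) * ENNReal.ofReal (C * R ^ d) := by gcongr; exact hS R hR
    _ = _ := by rw [← ENNReal.ofReal_mul (by positivity)]; congr 1; ring

/-- The condition 2tu ≤ R log u turns the linear excess at z into the lower endpoint u(1 + |z|/R).
The Pareto density there is of order u^(-α-1) (1 + |z|/R)^(-α-1), and its lattice sum is O(R^d). -/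
lemma exists_measure_tripleHit_window_le (hd : 1 ≤ d) (hα : (d : ℝ) < α) :
    ∃ C : ℝ, 0 < C ∧ ∀ {Ω : Type*} [MeasurableSpace Ω] {P : Measure Ω} [IsProbabilityMeasure P]
      {ξ : (Fin d → ℤ) → Ω → ℝ}, IsParetoField α P ξ → ∀ t R u w : ℝ, 0 < t → 1 ≤ R → 0 < u →
      4 ≤ Real.log u → 2 * (d * Real.log 3 + Real.log (1 + d * Real.log 3)) ≤ Real.log u → 0 < w →
      2 * t * u ≤ R * Real.log u →
      P (tripleHit ξ fun z => window t (l1 z) (eta z) u (u + w)) ≤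
        ENNReal.ofReal ((C * w * u ^ (-α - 1) * R ^ d) ^ 3) := by
  have hd0 : (0 : ℝ) < d := by exact_mod_cast hd
  have hα0 : 0 < α := by linarith
  obtain ⟨C, hC, hS⟩ := exists_sum_one_add_l1_div_rpow_le hd (γ := α + 1) (by linarith)
  refine ⟨5 * α * C, by positivity, fun {Ω} _ {P} _ {ξ} h t R u w ht hR hu hu4 huD hw hRu => ?_⟩
  have hR0 : 0 < R := by linarith
  have hD : 0 ≤ d * Real.log 3 := mul_nonneg hd0.le (Real.log_nonneg (by norm_num))
  have hu1 : 1 ≤ u := by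
    by_contra hlt
    have := Real.log_nonpos hu.le (not_le.1 hlt).le
    linarith
  have key : ∀ z : Fin d → ℤ, ∃ A B, u * (1 + l1 z / R) ≤ A ∧ A ≤ B ∧ B - A ≤ 5 * w ∧
      window t (l1 z) (eta z) u (u + w) ⊆ Set.Ico A B := by
    intro z
    obtain ⟨A, B, h1, h2⟩ := exists_window_subset_Ico (w := w) hD ht (Nat.cast_nonneg (l1 z))
      (eta_le z) hu hu4 huD hw
    refine ⟨A, B, le_trans ?_ h1, h2⟩
    rw [mul_add, mul_one]
    gcongr
    rw [mul_div_assoc', div_le_div_iff₀ hR0 (by positivity)]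
    calc u * l1 z * (2 * t) = l1 z * (2 * t * u) := by ring
      _ ≤ l1 z * (R * Real.log u) := by gcongr
      _ = _ := by ring
  choose A B hA hAB hBA hsub using key
  have hmono : tripleHit ξ (fun z => window t (l1 z) (eta z) u (u + w)) ⊆
      tripleHit ξ (fun z => Set.Ico (A z) (B z)) := by
    rintro ω ⟨x, y, z, h1, h2, h3, hx, hy, hz⟩
    exact ⟨x, y, z, h1, h2, h3, hsub x hx, hsub y hy, hsub z hz⟩
  have hterm : ∀ z, P (ξ z ⁻¹' Set.Ico (A z) (B z)) ≤
      ENNReal.ofReal (5 * α * w * u ^ (-α - 1)) *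
        ENNReal.ofReal ((1 + l1 z / R) ^ (-(α + 1))) := by
    intro z
    have h0 : (0 : ℝ) ≤ l1 z / R := by positivity
    have h3 : 1 ≤ u * (1 + l1 z / R) := one_le_mul_of_one_le_of_one_le hu1 (by linarith)
    refine (h.measure_Ico_le hα0.le z (h3.trans (hA z)) (hAB z)).trans ?_
    rw [← ENNReal.ofReal_mul (by positivity)]
    refine ENNReal.ofReal_le_ofReal ?_
    have h4 : A z ^ (-α - 1) ≤ (u * (1 + l1 z / R)) ^ (-α - 1) :=
      Real.rpow_le_rpow_of_nonpos (by linarith) (hA z) (by linarith)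
    rw [Real.mul_rpow hu.le (by linarith)] at h4
    have h5 : 0 ≤ B z - A z := by linarith [hAB z]
    calc α * A z ^ (-α - 1) * (B z - A z)
        ≤ α * (u ^ (-α - 1) * (1 + l1 z / R) ^ (-α - 1)) * (5 * w) := by
          gcongr
          exact hBA z
      _ = _ := by rw [show -(α + 1) = -α - 1 by ring]; ring
  calc P (tripleHit ξ fun z => window t (l1 z) (eta z) u (u + w))
      ≤ P (tripleHit ξ (fun z => Set.Ico (A z) (B z))) := measure_mono hmono
    _ ≤ (∑' z, P (ξ z ⁻¹' Set.Ico (A z) (B z))) ^ 3 :=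
        measure_tripleHit_le h.indep fun z => measurableSet_Ico
    _ ≤ (ENNReal.ofReal (5 * α * w * u ^ (-α - 1)) * ENNReal.ofReal (C * R ^ d)) ^ 3 := by
        gcongr
        refine (ENNReal.tsum_le_tsum hterm).trans ?_
        rw [ENNReal.tsum_mul_left]
        gcongr
        exact hS R hR
    _ = _ := by
        rw [← ENNReal.ofReal_mul (by positivity), ← ENNReal.ofReal_pow (by positivity)]
        congr 2
        ring

end IsParetoField

/-! ### Deterministic gap estimate on [T, 2T] -/

/-- Requirements on the scales at time `T`: `a` is the scale of the potential and of `Φ`, the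
maximum of `Φ` is at least `κ a`, the sites competing for it lie within distance `K a T / log T`
of the origin, and `a μ` is the size of the gap. -/
structure AdmissibleScales (d : ℕ) (q T a κ K μ : ℝ) : Prop where
  q_pos : 0 < q
  one_le_T : 1 ≤ T
  log_pos : 0 < Real.log T
  a_pos : 0 < a
  κ_pos : 0 < κ
  K_pos : 0 < K
  μ_pos : 0 < μ
  μ_le_κ : 8 * μ ≤ κ
  μ_le_K : μ ≤ 2 * q * K
  le_log : q / 2 * Real.log T ≤ Real.log (κ * a / 4)
  four_le_log : 4 ≤ Real.log (κ * a / 4)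
  const_le_log : 2 * (d * Real.log 3 + Real.log (1 + d * Real.log 3)) ≤ Real.log (κ * a / 4)
  log_le : Real.log (2 * κ * a) ≤ q * Real.log T
  log_K_le : Real.log (2 * (q / 24 * K * a)) ≤ 2 * q * Real.log T
  const_le : d * Real.log 3 ≤ 2 * q * Real.log T
  one_le : 1 ≤ q / 24 * K * a
  one_le_radius : 1 ≤ K * a * (T / Real.log T)

/-- The mesh of the time grid, relative to `T`. -/
def mesh (q K μ : ℝ) : ℝ := μ / (2 * q * K)

/-- The points of the time grid covering `[T, 2T]`. -/
def gridTime (q T K μ : ℝ) (i : ℕ) : ℝ := T * (1 + (i + 1) * mesh q K μ)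

/-- At some time of the grid, three distinct sites have values of `Φ` in a common interval of
length `4 a μ` at a level at least of order `κ a`. -/
def clusterEvent {d : ℕ} {Ω : Type*} (ξ : (Fin d → ℤ) → Ω → ℝ) (q T a κ K μ : ℝ) : Set Ω :=
  ⋃ i ∈ Finset.range (⌊1 / mesh q K μ⌋₊ + 1), ⋃ j : ℕ,
    tripleHit ξ fun z => window (gridTime q T K μ i) (l1 z) (eta z)
      (((⌈κ / (2 * μ)⌉₊ + j : ℕ) - 2 : ℝ) * (a * μ))
      (((⌈κ / (2 * μ)⌉₊ + j : ℕ) - 2 : ℝ) * (a * μ) + 4 * (a * μ))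

namespace AdmissibleScales

variable {d : ℕ} {q T a κ K μ : ℝ}

lemma mesh_pos (h : AdmissibleScales d q T a κ K μ) : 0 < mesh q K μ :=
  div_pos h.μ_pos (mul_pos (mul_pos two_pos h.q_pos) h.K_pos)

lemma mesh_le_one (h : AdmissibleScales d q T a κ K μ) : mesh q K μ ≤ 1 :=
  div_le_one_of_le₀ h.μ_le_K (mul_pos (mul_pos two_pos h.q_pos) h.K_pos).le

lemma gridTime_bounds (h : AdmissibleScales d q T a κ K μ) {i : ℕ}
    (hi : i ∈ Finset.range (⌊1 / mesh q K μ⌋₊ + 1)) :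
    T ≤ gridTime q T K μ i ∧ gridTime q T K μ i ≤ 3 * T := by
  have hT := h.one_le_T
  have h1 := h.mesh_pos
  have h2 := h.mesh_le_one
  have h3 : (i : ℝ) ≤ 1 / mesh q K μ := by
    refine le_trans ?_ (Nat.floor_le (by positivity))
    exact_mod_cast Nat.lt_succ_iff.1 (Finset.mem_range.1 hi)
  rw [le_div_iff₀ h1] at h3
  have h4 : 0 ≤ ((i : ℝ) + 1) * mesh q K μ := by positivity
  rw [gridTime]
  constructor <;> nlinarith

lemma log_bounds (h : AdmissibleScales d q T a κ K μ) {u : ℝ} (hu : κ * a / 4 ≤ u) :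
    0 < u ∧ q / 2 * Real.log T ≤ Real.log u ∧ 4 ≤ Real.log u ∧
      2 * (d * Real.log 3 + Real.log (1 + d * Real.log 3)) ≤ Real.log u := by
  have h0 : 0 < κ * a / 4 := div_pos (mul_pos h.κ_pos h.a_pos) (by norm_num)
  have h1 := Real.log_le_log h0 hu
  exact ⟨h0.trans_le hu, h.le_log.trans h1, h.four_le_log.trans h1, h.const_le_log.trans h1⟩

lemma four_le_ceil (h : AdmissibleScales d q T a κ K μ) : 4 ≤ ⌈κ / (2 * μ)⌉₊ := by
  have hμ := h.μ_pos
  have h1 : (4 : ℝ) ≤ κ / (2 * μ) := by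
    rw [le_div_iff₀ (by positivity)]; linarith [h.μ_le_κ]
  exact_mod_cast h1.trans (Nat.le_ceil _)

/-- Lower bound for the levels entering `clusterEvent`. -/
lemma le_level (h : AdmissibleScales d q T a κ K μ) {j : ℕ} (hj : ⌈κ / (2 * μ)⌉₊ ≤ j) :
    κ / 4 ≤ j * μ / 2 ∧ a * (j * μ / 2) ≤ ((j : ℝ) - 2) * (a * μ) := by
  have hμ := h.μ_pos
  have h1 : κ / (2 * μ) ≤ j := (Nat.le_ceil _).trans (by exact_mod_cast hj)
  have h2 : (4 : ℝ) ≤ j := by exact_mod_cast h.four_le_ceil.trans hj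
  rw [div_le_iff₀ (by positivity)] at h1
  refine ⟨by linarith, ?_⟩
  have := mul_le_mul_of_nonneg_right h2 (mul_pos h.a_pos hμ).le
  linarith

/-- The radius is chosen so that the cost (|z|/t) log(2κa) consumes at most half of 2κa;
monotonicity of the branch reduces to ξ(z) = 2κa, and η ≥ 0 is dropped. -/
lemma le_Phi (h : AdmissibleScales d q T a κ K μ) {ξ : (Fin d → ℤ) → ℝ} {t : ℝ} (ht : T ≤ t)
    {z : Fin d → ℤ} (hz : (l1 z : ℝ) ≤ κ * a * (T / Real.log T) / q) (hξ : 2 * κ * a ≤ ξ z) :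
    κ * a ≤ Phi ξ t z := by
  have hq := h.q_pos
  have hT : 0 < T := by linarith [h.one_le_T]
  have hL := h.log_pos
  have hκa : 0 < κ * a := mul_pos h.κ_pos h.a_pos
  have ht0 : 0 < t := hT.trans_le ht
  obtain ⟨-, -, h4, -⟩ := h.log_bounds (u := 2 * κ * a) (by linarith)
  have hqL : 4 ≤ q * Real.log T := h4.trans h.log_le
  have h5 : κ * a * (T / Real.log T) / q = κ * a * T / (q * Real.log T) := by field_simp
  rw [h5, le_div_iff₀ (by positivity)] at hz
  have h6 : (l1 z : ℝ) ≤ t * (2 * κ * a) := by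
    have h7 : (l1 z : ℝ) * 4 ≤ l1 z * (q * Real.log T) := by gcongr
    have h8 : κ * a * T ≤ κ * a * t := by gcongr
    linarith [mul_pos hκa ht0]
  have hx0 : 0 < 2 * κ * a := by linarith
  rw [Phi_eq_branch (h6.trans (by gcongr))]
  refine le_trans ?_ (branch_mono ht0 (Nat.cast_nonneg _) hx0 hξ h6)
  have h9 : (l1 z : ℝ) / t * Real.log (2 * κ * a) ≤ κ * a := by
    rw [div_mul_eq_mul_div, div_le_iff₀ ht0]
    calc (l1 z : ℝ) * Real.log (2 * κ * a) ≤ l1 z * (q * Real.log T) := by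
          gcongr; exact h.log_le
      _ ≤ κ * a * T := hz
      _ ≤ _ := by gcongr
  have h10 : 0 ≤ eta z / t := div_nonneg (eta_nonneg z) ht0.le
  rw [branch]
  linarith

/-- Localisation of the sites with large values of `Φ_t`. -/
lemma localisation (h : AdmissibleScales d q T a κ K μ) {ξ : (Fin d → ℤ) → ℝ} {t : ℝ}
    (ht : T ≤ t) (ht2 : t ≤ 2 * T) (hξ : ∀ z, 1 ≤ ξ z)
    (hup : ∀ z, ξ z < q / 24 * K * a * (1 + l1 z / (K * a * (T / Real.log T))))
    {z : Fin d → ℤ} (hz : κ * a / 4 ≤ Phi ξ t z) :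
    (l1 z : ℝ) ≤ t * ξ z ∧ (l1 z : ℝ) ≤ K * a * (T / Real.log T) ∧
      ξ z ≤ 2 * (q / 24 * K * a) := by
  have hq := h.q_pos
  have hT : 0 < T := by linarith [h.one_le_T]
  have ht0 : 0 < t := by linarith
  have hL := h.log_pos
  have ha := h.a_pos
  have hK := h.K_pos
  obtain ⟨h1, h2, h3, h4⟩ := h.log_bounds hz
  have hact := le_mul_of_Phi_pos h1
  have hD : 0 ≤ d * Real.log 3 := mul_nonneg (Nat.cast_nonneg d) (Real.log_nonneg (by norm_num))
  obtain ⟨h5, -⟩ := le_of_le_branch hD ht0 (Nat.cast_nonneg _) (eta_le z) (hξ z) hact h1 h3 h4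
    (Phi_eq_branch hact).le
  have h6 : q / 12 * (l1 z * (Real.log T / T)) ≤ ξ z := by
    have : q / 12 * (l1 z * (Real.log T / T)) ≤ l1 z * Real.log (Phi ξ t z) / (2 * t) := by
      rw [le_div_iff₀ (by positivity)]
      calc q / 12 * (l1 z * (Real.log T / T)) * (2 * t)
          = l1 z * (q / 2 * Real.log T) * (t / (3 * T)) := by field_simp; ring
        _ ≤ l1 z * (q / 2 * Real.log T) * 1 := by
            gcongr
            rw [div_le_one (by positivity)]; linarith
        _ ≤ _ := by rw [mul_one]; gcongr
    linarith
  have h7 : q / 24 * K * a * (1 + l1 z / (K * a * (T / Real.log T))) =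
      q / 24 * (K * a + l1 z * (Real.log T / T)) := by field_simp
  have h8 := hup z
  rw [h7] at h8
  -- A large value of Φ forces slope q/12 in |z| log T / T, while the envelope only has slope q/24;
  -- the two are incompatible beyond the radius.
  have h9 : (l1 z : ℝ) * (Real.log T / T) ≤ K * a := by
    by_contra hn
    have := mul_lt_mul_of_pos_left (not_le.1 hn) hq
    linarith
  refine ⟨hact, ?_, ?_⟩
  · rw [← mul_div_assoc, le_div_iff₀ hL]
    rwa [← mul_div_assoc, div_le_iff₀ hT] at h9
  · have := mul_le_mul_of_nonneg_left h9 hq.le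
    linarith

/-- Time enters only through 1/t, with coefficient |z| log x - η(z) of size at most 2qKaT. Over one
mesh step 1/t changes by at most `mesh q K μ / T`, and the product is aμ; this dictates the mesh. -/
lemma abs_branch_sub_le (h : AdmissibleScales d q T a κ K μ) {t s x : ℝ}
    (ht : T ≤ t) (hts : t ≤ s) (hst : s ≤ t + T * mesh q K μ) {z : Fin d → ℤ}
    (hz : (l1 z : ℝ) ≤ K * a * (T / Real.log T)) (hx : 1 ≤ x)
    (hx2 : x ≤ 2 * (q / 24 * K * a)) :
    |branch s (l1 z) (eta z) x - branch t (l1 z) (eta z) x| ≤ a * μ := by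
  have hq := h.q_pos
  have hT : 0 < T := by linarith [h.one_le_T]
  have ht0 : 0 < t := by linarith
  have hs0 : 0 < s := by linarith
  have hL := h.log_pos
  have ha := h.a_pos
  have hK := h.K_pos
  have h1 : Real.log x ≤ 2 * q * Real.log T :=
    (Real.log_le_log (by linarith) hx2).trans h.log_K_le
  have h0 : 0 ≤ Real.log x := Real.log_nonneg hx
  have h2 : |l1 z * Real.log x - eta z| ≤ l1 z * (2 * q * Real.log T) := by
    have h3 : l1 z * Real.log x ≤ l1 z * (2 * q * Real.log T) := by gcongr
    have h4 : eta z ≤ l1 z * (2 * q * Real.log T) := by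
      refine (eta_le z).trans ?_
      rw [mul_comm]
      exact mul_le_mul_of_nonneg_left h.const_le (Nat.cast_nonneg _)
    have := eta_nonneg z
    have : 0 ≤ l1 z * Real.log x := by positivity
    rw [abs_le]
    constructor <;> linarith
  have h5 : branch s (l1 z) (eta z) x - branch t (l1 z) (eta z) x =
      (l1 z * Real.log x - eta z) * ((s - t) / (t * s)) := by
    simp only [branch]; field_simp; ring
  have h6 : 0 ≤ (s - t) / (t * s) := div_nonneg (by linarith) (by positivity)
  have h7 : (s - t) / (t * s) ≤ mesh q K μ / T := by
    rw [div_le_div_iff₀ (by positivity) hT]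
    have hm := h.mesh_pos
    calc (s - t) * T ≤ T * mesh q K μ * T := by gcongr; linarith
      _ = mesh q K μ * (T * T) := by ring
      _ ≤ mesh q K μ * (t * s) := by gcongr; linarith
  rw [h5, abs_mul, abs_of_nonneg h6]
  have hm := h.mesh_pos
  calc |l1 z * Real.log x - eta z| * ((s - t) / (t * s))
      ≤ l1 z * (2 * q * Real.log T) * (mesh q K μ / T) := by gcongr
    _ ≤ K * a * (T / Real.log T) * (2 * q * Real.log T) * (mesh q K μ / T) := by gcongr
    _ = a * μ := by rw [mesh]; field_simp

lemma gap_le (h : AdmissibleScales d q T a κ K μ) {Ω : Type*} {ξ : (Fin d → ℤ) → Ω → ℝ} {ω : Ω}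
    (hξ : ∀ z, 1 ≤ ξ z ω)
    (hlow : ∃ z, (l1 z : ℝ) ≤ κ * a * (T / Real.log T) / q ∧ 2 * κ * a ≤ ξ z ω)
    (hup : ∀ z, ξ z ω < q / 24 * K * a * (1 + l1 z / (K * a * (T / Real.log T))))
    (hcluster : ω ∉ clusterEvent ξ q T a κ K μ) {t : ℝ} (ht : T ≤ t) (ht2 : t ≤ 2 * T)
    {z₁ z₂ z₃ : Fin d → ℤ} (hz : IsTopThree (Phi (fun z => ξ z ω) t) z₁ z₂ z₃) :
    a * μ ≤ Phi (fun z => ξ z ω) t z₁ - Phi (fun z => ξ z ω) t z₃ := by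
  by_contra hlt
  rw [not_le] at hlt
  set f := Phi (fun z => ξ z ω) t with hf
  have hμ := h.μ_pos
  have hκ := h.κ_pos
  have ha := h.a_pos
  have hT : 0 < T := by linarith [h.one_le_T]
  have hδ : 0 < a * μ := mul_pos ha hμ
  have hmesh := h.mesh_pos
  have hM : κ * a ≤ f z₁ := by
    obtain ⟨z, hz1, hz2⟩ := hlow
    exact (h.le_Phi (ξ := fun z => ξ z ω) ht hz1 hz2).trans (hz.max₁ z)
  have hμκ : 8 * (a * μ) ≤ κ * a := by
    have := mul_le_mul_of_nonneg_right h.μ_le_κ ha.le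
    linarith
  have h32 : f z₃ ≤ f z₂ := hz.max₂ _ hz.mem₃.1
  have h21 : f z₂ ≤ f z₁ := hz.max₁ _
  set j := ⌊f z₁ / (a * μ)⌋₊ with hj
  have hj1 : j * (a * μ) ≤ f z₁ := by
    rw [← le_div_iff₀ hδ]; exact Nat.floor_le (div_nonneg (by linarith) hδ.le)
  have hj2 : f z₁ < (j + 1) * (a * μ) := by
    rw [← div_lt_iff₀ hδ]; exact Nat.lt_floor_add_one _
  have hj0 : ⌈κ / (2 * μ)⌉₊ ≤ j := by
    rw [Nat.ceil_le, div_le_iff₀ (by positivity)]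
    have h1 : κ * a < (j + 1) * (a * μ) := hM.trans_lt hj2
    have h2 : κ < (j + 1) * μ := by
      refine lt_of_mul_lt_mul_right (a := a) ?_ ha.le
      linarith
    linarith [h.μ_le_κ]
  obtain ⟨k, hk⟩ := Nat.exists_eq_add_of_le hj0
  set x := (t / T - 1) / mesh q K μ with hx
  have hx0 : 0 ≤ x := by
    refine div_nonneg ?_ hmesh.le
    rw [sub_nonneg, one_le_div hT]; exact ht
  have hx1 : x ≤ 1 / mesh q K μ := by
    refine div_le_div_of_nonneg_right ?_ hmesh.le
    rw [sub_le_iff_le_add, div_le_iff₀ hT]; linarith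
  have htx : t = T * (1 + x * mesh q K μ) := by rw [hx]; field_simp; ring
  -- The time is rounded up to the grid, since the condition |z| ≤ tξ(z) persists when t grows.
  set i := ⌊x⌋₊ with hi
  have hi1 : (i : ℝ) ≤ x := Nat.floor_le hx0
  have hi2 : x < i + 1 := Nat.lt_floor_add_one x
  have himem : i ∈ Finset.range (⌊1 / mesh q K μ⌋₊ + 1) :=
    Finset.mem_range.2 (Nat.lt_succ_iff.2 (Nat.floor_mono hx1))
  have hTm : 0 < T * mesh q K μ := by positivity
  have hts : t ≤ gridTime q T K μ i := by
    rw [htx, gridTime]; gcongr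
  have hst : gridTime q T K μ i ≤ t + T * mesh q K μ := by
    rw [htx, gridTime]
    have := mul_le_mul_of_nonneg_right hi1 hTm.le
    linarith
  -- The value at time t lies between (j-1)aμ and (j+1)aμ. A drift of at most aμ to the grid time
  -- widens this to the window from (j-2)aμ to (j+2)aμ.
  have key : ∀ z, f z₁ - a * μ < f z → f z ≤ f z₁ →
      ξ z ω ∈ window (gridTime q T K μ i) (l1 z) (eta z) (((j : ℝ) - 2) * (a * μ))
        (((j : ℝ) - 2) * (a * μ) + 4 * (a * μ)) := by
    intro z hz1 hz2
    obtain ⟨h1, h2, h3⟩ := h.localisation (ξ := fun z => ξ z ω) ht ht2 hξ hup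
      (z := z) (by linarith)
    have h4 := abs_le.1 (h.abs_branch_sub_le ht hts hst h2 (hξ z) h3)
    rw [← Phi_eq_branch (ξ := fun z => ξ z ω) h1] at h4
    refine ⟨hξ z, h1.trans ?_, by linarith, by linarith⟩
    have := hξ z
    gcongr
  refine hcluster ?_
  simp only [clusterEvent, Set.mem_iUnion]
  refine ⟨i, himem, k, z₁, z₂, z₃, hz.mem₂.symm, hz.mem₃.1.symm, hz.mem₃.2.symm, ?_⟩
  rw [← hk]
  exact ⟨key z₁ (by linarith) le_rfl, key z₂ (by linarith) h21, key z₃ (by linarith)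
    (h32.trans h21)⟩

end AdmissibleScales

/-! ### Probabilities of low maxima and of clusters -/

lemma tsum_ofReal_inv_add_sq_le {m : ℕ} (hm : 2 ≤ m) :
    ∑' j : ℕ, ENNReal.ofReal (1 / ((m + j : ℕ) : ℝ) ^ 2) ≤ ENNReal.ofReal (2 / m) := by
  have hm' : (2 : ℝ) ≤ m := by exact_mod_cast hm
  rw [ENNReal.tsum_eq_iSup_nat]
  refine iSup_le fun n => ?_
  rw [← ENNReal.ofReal_sum_of_nonneg (fun _ _ => by positivity)]
  refine ENNReal.ofReal_le_ofReal ?_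
  have key : ∑ j ∈ Finset.range n, 1 / ((m + j : ℕ) : ℝ) ^ 2 ≤
      1 / ((m : ℝ) - 1) - 1 / ((m : ℝ) - 1 + n) := by
    induction n with
    | zero => simp
    | succ n ih =>
      rw [Finset.sum_range_succ]
      have hx : 0 < (m : ℝ) - 1 + n := by
        have : (0 : ℝ) ≤ n := Nat.cast_nonneg n
        linarith
      have h1 : 1 / ((m + n : ℕ) : ℝ) ^ 2 ≤
          1 / ((m : ℝ) - 1 + n) - 1 / ((m : ℝ) - 1 + (n + 1 : ℕ)) := by
        have h2 : ((m + n : ℕ) : ℝ) = ((m : ℝ) - 1 + n) + 1 := by push_cast; ring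
        have h3 : (m : ℝ) - 1 + (n + 1 : ℕ) = ((m : ℝ) - 1 + n) + 1 := by push_cast; ring
        rw [h2, h3]
        set x := (m : ℝ) - 1 + n
        rw [div_sub_div _ _ hx.ne' (by positivity), div_le_div_iff₀ (by positivity) (by positivity)]
        nlinarith
      linarith
  refine key.trans ?_
  have h0 : 0 ≤ 1 / ((m : ℝ) - 1 + n) := by
    have : (0 : ℝ) ≤ n := Nat.cast_nonneg n
    exact div_nonneg zero_le_one (by linarith)
  have h1 : 1 / ((m : ℝ) - 1) ≤ 2 / m := by
    rw [div_le_div_iff₀ (by linarith) (by linarith)]; linarith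
  linarith

namespace IsParetoField

variable {d : ℕ} {Ω : Type*} [MeasurableSpace Ω] {α : ℝ} {P : Measure Ω} [IsProbabilityMeasure P]
  {ξ : (Fin d → ℤ) → Ω → ℝ}

/-- The cube [0, ⌊ρ/d⌋]^d lies in the ball and has at least (ρ/d)^d sites, all of which would have
to be low. -/
lemma measure_forall_l1_le_lt_le (h : IsParetoField α P ξ) (hd : 1 ≤ d) (hα : 0 ≤ α) {ρ x : ℝ}
    (hρ : 0 ≤ ρ) (hx : 1 ≤ x) :
    P {ω | ∀ z, (l1 z : ℝ) ≤ ρ → ξ z ω < x} ≤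
      ENNReal.ofReal (Real.exp (-((ρ / d) ^ d * x ^ (-α)))) := by
  have hd0 : (0 : ℝ) < d := by exact_mod_cast hd
  set N := ⌊ρ / d⌋₊ with hN
  set s := Fintype.piFinset (fun _ : Fin d => Finset.Icc (0 : ℤ) N) with hs
  have hNρ : (N : ℝ) * d ≤ ρ := by
    rw [← le_div_iff₀ hd0]; exact Nat.floor_le (by positivity)
  have hsl : ∀ z ∈ s, (l1 z : ℝ) ≤ ρ := by
    intro z hz
    rw [hs, Fintype.mem_piFinset] at hz
    have h1 : l1 z ≤ d * N := by
      have : ∀ i ∈ Finset.univ, (z i).natAbs ≤ N := by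
        intro i _
        have := Finset.mem_Icc.1 (hz i)
        omega
      simpa [l1] using Finset.sum_le_card_nsmul _ _ _ this
    have h2 : (l1 z : ℝ) ≤ d * N := by exact_mod_cast h1
    linarith
  have hcard : (ρ / d) ^ d ≤ (s.card : ℝ) := by
    have h1 : s.card = (N + 1) ^ d := by
      rw [hs, Fintype.card_piFinset]
      simp
    rw [h1]
    push_cast
    gcongr
    exact (Nat.lt_floor_add_one _).le
  have hsub : {ω | ∀ z, (l1 z : ℝ) ≤ ρ → ξ z ω < x} ⊆ {ω | ∀ z ∈ s, ξ z ω < x} :=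
    fun ω hω z hz => hω z (hsl z hz)
  refine (measure_mono hsub).trans ((h.measure_forall_lt_le hα s hx).trans ?_)
  refine ENNReal.ofReal_le_ofReal (Real.exp_le_exp.2 (neg_le_neg ?_))
  gcongr

/-- At height about ay the expected number of hits is O(μ y^(-g-1)). Cubing, summing over levels y =
jμ/2 ≥ κ/4 and multiplying by O(K/μ) grid times gives the bound. -/
lemma exists_measure_clusterEvent_le (h : IsParetoField α P ξ) (hd : 1 ≤ d) (hα : (d : ℝ) < α)
    {q : ℝ} (hq : 0 < q) :
    ∃ C : ℝ, 0 < C ∧ ∀ T a κ K μ : ℝ, AdmissibleScales d q T a κ K μ →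
      a ^ (α - d) = (T / Real.log T) ^ d →
      P (clusterEvent ξ q T a κ K μ) ≤
        ENNReal.ofReal (C * (K * μ * κ ^ (-(3 * (α - d) + 2)))) := by
  obtain ⟨C, hC, hW⟩ := exists_measure_tripleHit_window_le hd hα
  set g := α - d with hg
  have hg0 : 0 < g := by rw [hg]; linarith
  set C₁ := C * 4 * (12 / q) ^ d with hC₁
  have hC₁0 : 0 < C₁ := by positivity
  set C₂ := C₁ ^ 3 * 4 * (1 / 4) ^ (-(3 * g + 1)) with hC₂
  have hC₂0 : 0 < C₂ := by positivity
  refine ⟨16 * q * C₂, by positivity, fun T a κ K μ hs hag => ?_⟩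
  have hT : 0 < T := by linarith [hs.one_le_T]
  have hL := hs.log_pos
  have ha := hs.a_pos
  have hκ := hs.κ_pos
  have hK := hs.K_pos
  have hμ := hs.μ_pos
  have hm := hs.mesh_pos
  set τ := T / Real.log T with hτ
  have hτ0 : 0 < τ := by positivity
  set m := ⌈κ / (2 * μ)⌉₊ with hmdef
  have hm4 : 4 ≤ m := hs.four_le_ceil
  -- the contribution of a single level
  have hlevel : ∀ i ∈ Finset.range (⌊1 / mesh q K μ⌋₊ + 1), ∀ j : ℕ,
      P (tripleHit ξ fun z => window (gridTime q T K μ i) (l1 z) (eta z)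
        (((m + j : ℕ) - 2 : ℝ) * (a * μ)) (((m + j : ℕ) - 2 : ℝ) * (a * μ) + 4 * (a * μ))) ≤
      ENNReal.ofReal (C₂ * μ * κ ^ (-(3 * g + 1))) *
        ENNReal.ofReal (1 / ((m + j : ℕ) : ℝ) ^ 2) := by
    intro i hi j
    set n := m + j with hn
    have hn0 : (0 : ℝ) < n := by
      have : 0 < n := by omega
      exact_mod_cast this
    obtain ⟨hy, hu⟩ := hs.le_level (j := n) (by omega)
    set y := (n : ℝ) * μ / 2 with hydef
    set u := ((n : ℝ) - 2) * (a * μ) with hudef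
    have hy0 : 0 < y := by positivity
    obtain ⟨hu0, hu1, hu4, huD⟩ := hs.log_bounds (u := u) (by
      refine le_trans ?_ hu
      rw [mul_comm, mul_div_assoc]
      gcongr)
    obtain ⟨hsT, hsT3⟩ := hs.gridTime_bounds hi
    have hRu : 2 * gridTime q T K μ i * u ≤ 12 / q * u * τ * Real.log u := by
      calc 2 * gridTime q T K μ i * u ≤ 2 * (3 * T) * u := by gcongr
        _ = 12 / q * u * τ * (q / 2 * Real.log T) := by rw [hτ]; field_simp; norm_num
        _ ≤ _ := by gcongr
    -- If this radius were below 1, `hRu` would contradict log u ≤ u, as grid times are at least 1.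
    have hR1 : 1 ≤ 12 / q * u * τ := by
      by_contra hlt
      have h1 : Real.log u ≤ u := (Real.log_le_sub_one_of_pos hu0).trans (by linarith)
      have h2 : 12 / q * u * τ * Real.log u ≤ 1 * u :=
        mul_le_mul (not_le.1 hlt).le h1 (by linarith) zero_le_one
      have h3 : 2 * 1 * u ≤ 2 * gridTime q T K μ i * u := by
        gcongr; linarith [hs.one_le_T]
      linarith
    refine (hW h _ _ u (4 * (a * μ)) (by linarith) hR1 hu0 hu4 huD (by positivity) hRu).trans ?_
    rw [← ENNReal.ofReal_mul (by positivity)]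
    refine ENNReal.ofReal_le_ofReal ?_
    have hbase : C * (4 * (a * μ)) * u ^ (-α - 1) * (12 / q * u * τ) ^ d ≤
        C₁ * μ * y ^ (-g - 1) := by
      have h1 : u ^ (-α - 1) * (12 / q * u * τ) ^ d = (12 / q) ^ d * τ ^ d * u ^ (-g - 1) := by
        rw [mul_pow, mul_pow, ← Real.rpow_natCast u d]
        have : u ^ (-α - 1) * u ^ (d : ℝ) = u ^ (-g - 1) := by
          rw [← Real.rpow_add hu0]; congr 1; rw [hg]; ring
        rw [← this]; ring
      have h2 : u ^ (-g - 1) ≤ (a * y) ^ (-g - 1) :=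
        Real.rpow_le_rpow_of_nonpos (by positivity) hu (by linarith)
      -- The relation a^g = τ^d removes every power of a and τ.
      have h3 : a * a ^ (-g - 1) * τ ^ d = 1 := by
        rw [← hag, Real.rpow_sub_one ha.ne', Real.rpow_neg ha.le]
        field_simp
      rw [mul_assoc, h1]
      calc C * (4 * (a * μ)) * ((12 / q) ^ d * τ ^ d * u ^ (-g - 1))
          ≤ C * (4 * (a * μ)) * ((12 / q) ^ d * τ ^ d * (a * y) ^ (-g - 1)) := by gcongr
        _ = C₁ * μ * y ^ (-g - 1) * (a * a ^ (-g - 1) * τ ^ d) := by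
            rw [Real.mul_rpow ha.le hy0.le, hC₁]; ring
        _ = _ := by rw [h3, mul_one]
    -- A factor y^(-2) is kept to sum over levels; the remaining power is bounded at its lowest
    -- level κ/4.
    have hy3 : (y ^ (-g - 1)) ^ 3 ≤
        (1 / 4) ^ (-(3 * g + 1)) * κ ^ (-(3 * g + 1)) * (4 / ((n : ℝ) ^ 2 * μ ^ 2)) := by
      have h1 : (y ^ (-g - 1)) ^ 3 = y ^ (-(3 * g + 1)) * (y ^ 2)⁻¹ := by
        rw [← Real.rpow_natCast, ← Real.rpow_mul hy0.le, ← Real.rpow_natCast y 2,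
          ← Real.rpow_neg hy0.le, ← Real.rpow_add hy0]
        congr 1; push_cast; ring
      have h2 : y ^ (-(3 * g + 1)) ≤ (κ / 4) ^ (-(3 * g + 1)) :=
        Real.rpow_le_rpow_of_nonpos (by positivity) hy (by linarith)
      have h3 : (κ / 4) ^ (-(3 * g + 1)) = (1 / 4) ^ (-(3 * g + 1)) * κ ^ (-(3 * g + 1)) := by
        rw [← Real.mul_rpow (by norm_num) hκ.le]; congr 1; ring
      have h4 : (y ^ 2)⁻¹ = 4 / ((n : ℝ) ^ 2 * μ ^ 2) := by rw [hydef]; field_simp; norm_num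
      rw [h1, ← h3, ← h4]
      gcongr
    calc (C * (4 * (a * μ)) * u ^ (-α - 1) * (12 / q * u * τ) ^ d) ^ 3
        ≤ (C₁ * μ * y ^ (-g - 1)) ^ 3 := by gcongr
      _ = C₁ ^ 3 * μ ^ 3 * (y ^ (-g - 1)) ^ 3 := by ring
      _ ≤ C₁ ^ 3 * μ ^ 3 * ((1 / 4) ^ (-(3 * g + 1)) * κ ^ (-(3 * g + 1)) *
            (4 / ((n : ℝ) ^ 2 * μ ^ 2))) := by gcongr
      _ = _ := by rw [hC₂]; field_simp
  have hI : ((⌊1 / mesh q K μ⌋₊ + 1 : ℕ) : ℝ) ≤ 4 * q * K / μ := by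
    have h1 : (⌊1 / mesh q K μ⌋₊ : ℝ) ≤ 1 / mesh q K μ := Nat.floor_le (by positivity)
    have h2 : 1 ≤ 1 / mesh q K μ := by rw [le_div_iff₀ hm, one_mul]; exact hs.mesh_le_one
    have h3 : 1 / mesh q K μ = 2 * q * K / μ := by rw [mesh, one_div_div]
    have h4 : 4 * q * K / μ = 2 * (2 * q * K / μ) := by ring
    push_cast
    rw [h4, ← h3]
    linarith
  have hmκ : 2 / (m : ℝ) ≤ 4 * μ / κ := by
    have h1 : κ / (2 * μ) ≤ m := Nat.le_ceil _
    calc 2 / (m : ℝ) ≤ 2 / (κ / (2 * μ)) := by gcongr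
      _ = _ := by field_simp; norm_num
  calc P (clusterEvent ξ q T a κ K μ)
      ≤ ∑ _i ∈ Finset.range (⌊1 / mesh q K μ⌋₊ + 1),
          ENNReal.ofReal (C₂ * μ * κ ^ (-(3 * g + 1))) * ENNReal.ofReal (4 * μ / κ) := by
        refine (measure_biUnion_finset_le _ _).trans (Finset.sum_le_sum fun i hi => ?_)
        refine (measure_iUnion_le _).trans ((ENNReal.tsum_le_tsum (hlevel i hi)).trans ?_)
        rw [ENNReal.tsum_mul_left]
        gcongr
        exact (tsum_ofReal_inv_add_sq_le (by omega)).trans (ENNReal.ofReal_le_ofReal hmκ)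
    _ = ENNReal.ofReal ((⌊1 / mesh q K μ⌋₊ + 1 : ℕ) *
          (C₂ * μ * κ ^ (-(3 * g + 1)) * (4 * μ / κ))) := by
        rw [Finset.sum_const, Finset.card_range, nsmul_eq_mul,
          ← ENNReal.ofReal_mul (by positivity), ENNReal.ofReal_mul (Nat.cast_nonneg _),
          ENNReal.ofReal_natCast]
    _ ≤ _ := by
        refine ENNReal.ofReal_le_ofReal ?_
        have h1 : κ ^ (-(3 * g + 2)) = κ ^ (-(3 * g + 1)) / κ := by
          rw [← Real.rpow_sub_one hκ.ne']; congr 1; ring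
        calc ((⌊1 / mesh q K μ⌋₊ + 1 : ℕ) : ℝ) * (C₂ * μ * κ ^ (-(3 * g + 1)) * (4 * μ / κ))
            ≤ 4 * q * K / μ * (C₂ * μ * κ ^ (-(3 * g + 1)) * (4 * μ / κ)) := by gcongr
          _ = _ := by rw [h1]; field_simp; norm_num

end IsParetoField

/-! ### Finite range of Φ_t and asymptotics of the scales -/

lemma finite_l1_le {d : ℕ} (B : ℝ) : {z : Fin d → ℤ | (l1 z : ℝ) ≤ B}.Finite := by
  refine (Set.finite_Icc (fun _ : Fin d => -(⌊B⌋₊ : ℤ)) (fun _ => (⌊B⌋₊ : ℤ))).subset fun z hz => ?_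
  have h1 : l1 z ≤ ⌊B⌋₊ := Nat.le_floor hz
  rw [Set.mem_Icc, Pi.le_def, Pi.le_def]
  constructor <;> intro i <;>
  · have := natAbs_le_l1 z i
    omega

/-- Only sites with |z| ≤ 2A can be active; all others contribute the value 0. -/
lemma finite_range_Phi {d : ℕ} {ξ : (Fin d → ℤ) → ℝ} {t A : ℝ}
    (h : ∀ z, t * ξ z < A + l1 z / 2) : (Set.range (Phi ξ t)).Finite := by
  refine (((finite_l1_le (d := d) (2 * A)).image (Phi ξ t)).union (Set.finite_singleton 0)).subset ?_
  rintro _ ⟨z, rfl⟩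
  by_cases hz : (l1 z : ℝ) ≤ t * ξ z
  · exact Or.inl ⟨z, by
      have := h z
      simp only [Set.mem_ofPred_eq]
      linarith, rfl⟩
  · exact Or.inr (by rw [Phi, if_neg hz]; rfl)

lemma eventually_mul_log_add_le (A B : ℝ) {C : ℝ} (hC : 0 < C) :
    ∀ᶠ x : ℝ in atTop, A * Real.log x + B ≤ C * x := by
  have h1 : (fun x : ℝ => A * Real.log x + B) =o[atTop] (id : ℝ → ℝ) :=
    (Real.isLittleO_log_id_atTop.const_mul_left A).add
      (Asymptotics.isLittleO_const_id_atTop B)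
  filter_upwards [h1.bound hC, eventually_ge_atTop 0] with x hx hx0
  rw [id, Real.norm_of_nonneg hx0] at hx
  exact (le_abs_self _).trans hx

lemma aScale_mul_lambdaScale_le {d : ℕ} {α β T t : ℝ} (hα : (d : ℝ) < α) (hβ : 0 ≤ β)
    (hT : 0 < T) (hL : 0 < Real.log T) (ht : T ≤ t) (ht2 : t ≤ 2 * T) :
    aScale d α t * lambdaScale β t ≤
      aScale d α T * (2 ^ ((d : ℝ) / (α - d)) * Real.log T ^ (-β)) := by
  have hq : 0 ≤ (d : ℝ) / (α - d) := div_nonneg (Nat.cast_nonneg d) (by linarith)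
  have hlog : Real.log T ≤ Real.log t := Real.log_le_log hT ht
  have ht0 : 0 < t := by linarith
  have h1 : aScale d α t ≤ 2 ^ ((d : ℝ) / (α - d)) * aScale d α T := by
    rw [aScale, aScale, ← Real.mul_rpow (by norm_num) (by positivity), mul_div_assoc']
    refine Real.rpow_le_rpow (div_nonneg ht0.le (by linarith)) ?_ hq
    gcongr
  have h2 : lambdaScale β t ≤ Real.log T ^ (-β) :=
    Real.rpow_le_rpow_of_nonpos hL hlog (by linarith)
  have h3 : 0 ≤ lambdaScale β t := Real.rpow_nonneg (by linarith) _
  calc aScale d α t * lambdaScale β t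
      ≤ 2 ^ ((d : ℝ) / (α - d)) * aScale d α T * Real.log T ^ (-β) :=
        mul_le_mul h1 h2 h3 (mul_nonneg (by positivity) (Real.rpow_nonneg (by positivity) _))
    _ = _ := by ring

lemma aScale_rpow {d : ℕ} {α T : ℝ} (hα : (d : ℝ) < α) (hT : 0 ≤ T / Real.log T) :
    aScale d α T ^ (α - d) = (T / Real.log T) ^ d := by
  have : α - d ≠ 0 := by linarith
  rw [aScale, ← Real.rpow_mul hT, div_mul_cancel₀ _ this, Real.rpow_natCast]

/-- Since log a = q(log T - log log T) and log κ, log K are multiples of log log T, the logarithmic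
requirements compare log log T with log T. The two bounds on μ compare powers of log T. -/
lemma eventually_admissibleScales {d : ℕ} (hd : 1 ≤ d) {α β ε k : ℝ} (hα : (d : ℝ) < α)
    (hε : 0 < ε) (hεβ : ε < β) (hk : 0 < k) :
    ∀ᶠ T : ℝ in atTop, AdmissibleScales d (d / (α - d)) T (aScale d α T) (Real.log T ^ (-ε))
      (Real.log T ^ k) (2 ^ ((d : ℝ) / (α - d)) * Real.log T ^ (-β)) := by
  have hd0 : (0 : ℝ) < d := by exact_mod_cast hd
  set q : ℝ := d / (α - d) with hqdef
  have hq : 0 < q := div_pos hd0 (by linarith)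
  set E : ℝ := 2 * (d * Real.log 3 + Real.log (1 + d * Real.log 3)) with hE
  have hlim := Real.tendsto_log_atTop
  have hloglim := hlim.comp hlim
  have hpow : Tendsto (fun x : ℝ => x ^ (-(β - ε))) atTop (nhds 0) :=
    tendsto_rpow_neg_atTop (by linarith)
  filter_upwards [eventually_ge_atTop (1 : ℝ), hlim.eventually_ge_atTop 1,
    hlim.eventually (hpow.eventually_le_const (u := 1 / (8 * 2 ^ q)) (by positivity)),
    hlim.eventually ((tendsto_rpow_neg_atTop (y := β + k) (by linarith)).eventually_le_const
      (u := 2 * q / 2 ^ q) (by positivity)),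
    hlim.eventually (eventually_mul_log_add_le (q + ε) (Real.log 4) (C := q / 2) (by positivity)),
    hlim.eventually_ge_atTop (4 * (2 / q)), hlim.eventually_ge_atTop (E * (2 / q)),
    hloglim.eventually_ge_atTop (Real.log 2 / (q + ε)),
    hlim.eventually (eventually_mul_log_add_le (k - q) (Real.log (2 * (q / 24))) hq),
    hlim.eventually_ge_atTop (d * Real.log 3 * (1 / (2 * q))),
    hlim.eventually (eventually_mul_log_add_le (q - k) (-Real.log (q / 24)) hq),
    hlim.eventually (eventually_mul_log_add_le (q + 1 - k) 0 (C := q + 1) (by positivity))]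
    with T hT1 hL1 h1 h2 h3 h4 h5 h6 h7 h8 h9 h10
  simp only [Function.comp_apply] at h6
  have hT : 0 < T := by linarith
  set L := Real.log T with hLdef
  have hL : 0 < L := by linarith
  have hτ : 0 < T / L := by positivity
  set a := aScale d α T with hadef
  have ha : 0 < a := Real.rpow_pos_of_pos hτ _
  set κ := L ^ (-ε) with hκdef
  have hκ : 0 < κ := by positivity
  set K := L ^ k with hKdef
  have hK : 0 < K := by positivity
  have hlogτ : Real.log (T / L) = L - Real.log L := by rw [Real.log_div hT.ne' hL.ne']
  have hloga : Real.log a = q * (L - Real.log L) := by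
    rw [hadef, aScale, Real.log_rpow hτ, hlogτ]
  have hlogκ : Real.log κ = -ε * Real.log L := Real.log_rpow hL _
  have hlogK : Real.log K = k * Real.log L := Real.log_rpow hL _
  have hlogκa : q / 2 * L ≤ Real.log (κ * a / 4) := by
    rw [Real.log_div (by positivity) (by norm_num), Real.log_mul hκ.ne' ha.ne', hloga, hlogκ]
    linarith
  have hmulq : ∀ x : ℝ, x * (2 / q) ≤ L → x ≤ Real.log (κ * a / 4) := by
    intro x hx
    refine le_trans ?_ hlogκa
    have := mul_le_mul_of_nonneg_left hx (by positivity : 0 ≤ q / 2)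
    calc x = q / 2 * (x * (2 / q)) := by field_simp
      _ ≤ _ := this
  refine ⟨hq, hT1, hL, ha, hκ, hK, by positivity, ?_, ?_, hlogκa, hmulq _ h4, hmulq _ h5, ?_, ?_,
    ?_, ?_, ?_⟩
  · have h : L ^ (-β) = L ^ (-(β - ε)) * κ := by
      rw [hκdef, ← Real.rpow_add hL]; congr 1; ring
    rw [h]
    calc 8 * (2 ^ q * (L ^ (-(β - ε)) * κ)) = 8 * 2 ^ q * L ^ (-(β - ε)) * κ := by ring
      _ ≤ 8 * 2 ^ q * (1 / (8 * 2 ^ q)) * κ := by gcongr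
      _ = κ := by field_simp
  · have h : L ^ (-β) = L ^ (-(β + k)) * K := by
      rw [hKdef, ← Real.rpow_add hL]; congr 1; ring
    rw [h]
    calc 2 ^ q * (L ^ (-(β + k)) * K) = 2 ^ q * L ^ (-(β + k)) * K := by ring
      _ ≤ 2 ^ q * (2 * q / 2 ^ q) * K := by gcongr
      _ = 2 * q * K := by field_simp
  · rw [Real.log_mul (by positivity) ha.ne', Real.log_mul (by norm_num) hκ.ne', hloga, hlogκ]
    rw [div_le_iff₀ (by positivity)] at h6
    linarith
  · rw [← mul_assoc, ← mul_assoc, Real.log_mul (by positivity) ha.ne',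
      Real.log_mul (by positivity) hK.ne', hloga, hlogK]
    linarith
  · have := mul_le_mul_of_nonneg_left h8 (by positivity : 0 ≤ 2 * q)
    calc d * Real.log 3 = 2 * q * (d * Real.log 3 * (1 / (2 * q))) := by field_simp
      _ ≤ _ := this
  · rw [← Real.log_nonneg_iff (by positivity), Real.log_mul (by positivity) ha.ne',
      Real.log_mul (by positivity) hK.ne', hloga, hlogK]
    linarith
  · rw [← Real.log_nonneg_iff (by positivity), Real.log_mul (by positivity) hτ.ne',
      Real.log_mul hK.ne' ha.ne', hloga, hlogK, hlogτ]
    linarith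

/-! ### Exceptional events and Borel–Cantelli -/

/-- The configurations that are not controlled on the time interval `[T, 2T]`. -/
def exceptionalEvent {d : ℕ} {Ω : Type*} (ξ : (Fin d → ℤ) → Ω → ℝ) (q T a κ K μ : ℝ) : Set Ω :=
  {ω | ∀ z, (l1 z : ℝ) ≤ κ * a * (T / Real.log T) / q → ξ z ω < 2 * κ * a} ∪
    {ω | ∃ z, q / 24 * K * a * (1 + l1 z / (K * a * (T / Real.log T))) ≤ ξ z ω} ∪
    clusterEvent ξ q T a κ K μ

/-- The scales balance the three events: κ^(-g) = L^(εg) makes a low maximum stretched-exponentially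
unlikely in L, K^(-g) = L^(-(1+ε)) controls the envelope, and `hβ` is exactly the equation K L^(-β)
κ^(-(3g+2)) = L^(-(1+ε)). -/
lemma IsParetoField.exists_measure_exceptionalEvent_le {d : ℕ} {Ω : Type*} [MeasurableSpace Ω]
    {α : ℝ} {P : Measure Ω} [IsProbabilityMeasure P] {ξ : (Fin d → ℤ) → Ω → ℝ}
    (h : IsParetoField α P ξ) (hd : 1 ≤ d) (hα : (d : ℝ) < α) {β ε : ℝ} (hε : 0 < ε)
    (hβ : 1 + 1 / (α - d) + ε * (1 / (α - d) + 3 * (α - d) + 3) = β) :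
    ∃ C : ℝ, 0 < C ∧ ∀ᶠ T : ℝ in atTop,
      P (exceptionalEvent ξ (d / (α - d)) T (aScale d α T) (Real.log T ^ (-ε))
        (Real.log T ^ ((1 + ε) / (α - d))) (2 ^ ((d : ℝ) / (α - d)) * Real.log T ^ (-β))) ≤
        ENNReal.ofReal (C * Real.log T ^ (-(1 + ε))) := by
  have hd0 : (0 : ℝ) < d := by exact_mod_cast hd
  have hα0 : 0 < α := by linarith
  set g := α - d with hg
  have hg0 : 0 < g := by rw [hg]; linarith
  set q : ℝ := d / g with hqdef
  have hq : 0 < q := div_pos hd0 hg0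
  set k := (1 + ε) / g with hk
  have hk0 : 0 < k := by positivity
  have hεβ : ε < β := by
    have h1 : 0 < 1 / g := by positivity
    have h2 : 0 < ε * (1 / g + 3 * g) := by positivity
    linarith
  obtain ⟨C₁, hC₁, hB⟩ := exists_measure_exists_ge_le hd hα
  obtain ⟨C₂, hC₂, hE⟩ := h.exists_measure_clusterEvent_le hd hα hq
  set c₀ : ℝ := (1 / (q * d)) ^ d * 2 ^ (-α) with hc₀
  have hc₀0 : 0 < c₀ := by positivity
  refine ⟨1 + C₁ * (q / 24) ^ (-α) + C₂ * 2 ^ q, by positivity, ?_⟩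
  have hlim := Real.tendsto_log_atTop
  have hexp : ∀ᶠ x : ℝ in atTop, (1 + ε) * Real.log x ≤ c₀ * x ^ (ε * g) := by
    have h1 := (isLittleO_log_rpow_atTop (r := ε * g) (by positivity)).const_mul_left (1 + ε)
    filter_upwards [h1.bound hc₀0, eventually_ge_atTop 0] with x hx hx0
    rw [Real.norm_of_nonneg (Real.rpow_nonneg hx0 _)] at hx
    exact (le_abs_self _).trans hx
  filter_upwards [eventually_admissibleScales hd hα hε hεβ hk0, hlim.eventually hexp]
    with T hs hexpT
  have hag := aScale_rpow (T := T) hα (by have := hs.log_pos; have := hs.one_le_T; positivity)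
  have hT : 0 < T := by linarith [hs.one_le_T]
  have ha := hs.a_pos
  have hκ := hs.κ_pos
  have hK := hs.K_pos
  have hL := hs.log_pos
  set L := Real.log T with hLdef
  set τ := T / L with hτdef
  have hτ : 0 < τ := by positivity
  set a := aScale d α T with hadef
  set κ := L ^ (-ε) with hκdef
  set K := L ^ k with hKdef
  set μ := 2 ^ q * L ^ (-β) with hμdef
  have hpow : ∀ x : ℝ, 0 < x → x ^ d * x ^ (-α) = x ^ (-g) := by
    intro x hx
    rw [← Real.rpow_natCast, ← Real.rpow_add hx]; congr 1; rw [hg]; ring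
  have hatau : a ^ (-g) * τ ^ d = 1 := by
    rw [← hag, ← Real.rpow_add ha, neg_add_cancel, Real.rpow_zero]
  have hlow : P {ω | ∀ z, (l1 z : ℝ) ≤ κ * a * τ / q → ξ z ω < 2 * κ * a} ≤
      ENNReal.ofReal (L ^ (-(1 + ε))) := by
    have hx1 : 1 ≤ 2 * κ * a := by
      obtain ⟨h0, -, h4, -⟩ := hs.log_bounds (u := 2 * κ * a) (by linarith [mul_pos hκ ha])
      rw [← Real.log_nonneg_iff h0]; linarith
    refine (h.measure_forall_l1_le_lt_le hd hα0.le (by positivity) hx1).trans ?_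
    refine ENNReal.ofReal_le_ofReal ?_
    have h1 : (κ * a * τ / q / d) ^ d * (2 * κ * a) ^ (-α) = c₀ * L ^ (ε * g) := by
      have h2 : κ * a * τ / q / d = 1 / (q * d) * (κ * (a * τ)) := by field_simp
      have h3 : κ ^ (-g) = L ^ (ε * g) := by rw [hκdef, ← Real.rpow_mul hL.le]; congr 1; ring
      rw [h2, Real.mul_rpow (by positivity) ha.le, Real.mul_rpow (by norm_num) hκ.le, mul_pow,
        mul_pow, mul_pow, hc₀]
      calc (1 / (q * d)) ^ d * (κ ^ d * (a ^ d * τ ^ d)) * (2 ^ (-α) * κ ^ (-α) * a ^ (-α))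
          = (1 / (q * d)) ^ d * 2 ^ (-α) * (κ ^ d * κ ^ (-α)) * (a ^ d * a ^ (-α) * τ ^ d) := by
            ring
        _ = _ := by rw [hpow κ hκ, hpow a ha, hatau, h3, mul_one]
    rw [h1, Real.rpow_def_of_pos hL (-(1 + ε))]
    exact Real.exp_le_exp.2 (by linarith)
  have hup : P {ω | ∃ z, q / 24 * K * a * (1 + l1 z / (K * a * τ)) ≤ ξ z ω} ≤
      ENNReal.ofReal (C₁ * (q / 24) ^ (-α) * L ^ (-(1 + ε))) := by
    refine (hB h _ _ hs.one_le hs.one_le_radius).trans (ENNReal.ofReal_le_ofReal (le_of_eq ?_))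
    have h3 : K ^ (-g) = L ^ (-(1 + ε)) := by
      rw [hKdef, ← Real.rpow_mul hL.le, hk]; congr 1; field_simp
    rw [Real.mul_rpow (by positivity) ha.le, Real.mul_rpow (by positivity) hK.le, mul_pow, mul_pow]
    calc C₁ * ((q / 24) ^ (-α) * K ^ (-α) * a ^ (-α)) * (K ^ d * a ^ d * τ ^ d)
        = C₁ * (q / 24) ^ (-α) * (K ^ d * K ^ (-α)) * (a ^ d * a ^ (-α) * τ ^ d) := by ring
      _ = _ := by rw [hpow K hK, hpow a ha, hatau, h3, mul_one]
  have hcl : P (clusterEvent ξ q T a κ K μ) ≤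
      ENNReal.ofReal (C₂ * 2 ^ q * L ^ (-(1 + ε))) := by
    refine (hE T a κ K μ hs hag).trans (ENNReal.ofReal_le_ofReal (le_of_eq ?_))
    have h3 : K * L ^ (-β) * κ ^ (-(3 * g + 2)) = L ^ (-(1 + ε)) := by
      rw [hKdef, hκdef, ← Real.rpow_mul hL.le, ← Real.rpow_add hL, ← Real.rpow_add hL]
      congr 1
      rw [← hβ, hk]
      field_simp
      ring
    rw [← h3, hμdef]
    ring
  calc P (exceptionalEvent ξ q T a κ K μ)
      ≤ ENNReal.ofReal (L ^ (-(1 + ε))) +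
          ENNReal.ofReal (C₁ * (q / 24) ^ (-α) * L ^ (-(1 + ε))) +
          ENNReal.ofReal (C₂ * 2 ^ q * L ^ (-(1 + ε))) :=
        (measure_union_le _ _).trans (add_le_add ((measure_union_le _ _).trans
          (add_le_add hlow hup)) hcl)
    _ = _ := by
        rw [← ENNReal.ofReal_add (by positivity) (by positivity),
          ← ENNReal.ofReal_add (by positivity) (by positivity)]
        congr 1
        ring

/-- Along T = 2^n the logarithm is n log 2, so the bounds are summable and Borel–Cantelli applies.
-/
lemma ae_eventually_notMem_of_measure_le_log {Ω : Type*} [MeasurableSpace Ω] {P : Measure Ω}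
    {E : ℝ → Set Ω} {C ε : ℝ} (hε : 0 < ε)
    (hE : ∀ᶠ T : ℝ in atTop, P (E T) ≤ ENNReal.ofReal (C * Real.log T ^ (-(1 + ε)))) :
    ∀ᵐ ω ∂P, ∀ᶠ n : ℕ in atTop, ω ∉ E (2 ^ n) := by
  have h2 : Tendsto (fun n : ℕ => (2 : ℝ) ^ n) atTop atTop :=
    tendsto_pow_atTop_atTop_of_one_lt (by norm_num)
  obtain ⟨N, hN⟩ := eventually_atTop.1 (h2.eventually hE)
  have hlog : 0 < Real.log 2 := Real.log_pos (by norm_num)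
  have hsum : Summable fun n : ℕ => C * Real.log 2 ^ (-(1 + ε)) * ((n + N : ℕ) : ℝ) ^ (-(1 + ε)) :=
    ((summable_nat_add_iff N).2 (Real.summable_nat_rpow.2 (by linarith))).mul_left _
  have hne : ∑' n : ℕ, P (E (2 ^ (n + N))) ≠ ⊤ := by
    refine ne_top_of_le_ne_top hsum.tsum_ofReal_ne_top (ENNReal.tsum_le_tsum fun n => ?_)
    refine (hN (n + N) (Nat.le_add_left _ _)).trans (ENNReal.ofReal_le_ofReal (le_of_eq ?_))
    rw [Real.log_pow, Real.mul_rpow (Nat.cast_nonneg _) hlog.le]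
    ring
  filter_upwards [ae_eventually_notMem hne] with ω hω
  obtain ⟨M, hM⟩ := eventually_atTop.1 hω
  refine eventually_atTop.2 ⟨M + N, fun n hn => ?_⟩
  have := hM (n - N) (by omega)
  rwa [Nat.sub_add_cancel (by omega)] at this

end ParabolicAnderson

end

theorem proposition3p4 {d : ℕ} (hd : 1 ≤ d) {α β : ℝ} (hα : (d : ℝ) < α)
    (hβ : 1 + 1 / (α - d) < β)
    {Ω : Type*} [MeasurableSpace Ω] (P : Measure Ω) [IsProbabilityMeasure P]
    (ξ : (Fin d → ℤ) → Ω → ℝ) (hmeas : ∀ z, Measurable (ξ z)) (hindep : iIndepFun ξ P)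
    (hpareto : ∀ z, ∀ x : ℝ, 1 ≤ x → P.real {ω | ξ z ω < x} = 1 - x ^ (-α)) :
    ∀ᵐ ω ∂P,
      (∀ t : ℝ, 0 < t → ∃ z₁ z₂ z₃ : Fin d → ℤ,
        ParabolicAnderson.IsTopThree (ParabolicAnderson.Phi (fun z => ξ z ω) t) z₁ z₂ z₃) ∧
      ∀ᶠ t : ℝ in atTop, ∀ z₁ z₂ z₃ : Fin d → ℤ,
        ParabolicAnderson.IsTopThree (ParabolicAnderson.Phi (fun z => ξ z ω) t) z₁ z₂ z₃ →
        ParabolicAnderson.aScale d α t * ParabolicAnderson.lambdaScale β t ≤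
          ParabolicAnderson.Phi (fun z => ξ z ω) t z₁
            - ParabolicAnderson.Phi (fun z => ξ z ω) t z₃ := by
  have hfield : ParabolicAnderson.IsParetoField α P ξ := ⟨hmeas, hindep, hpareto⟩
  have hg0 : 0 < α - d := by linarith
  have hinv : 0 < 1 / (α - d) := by positivity
  -- The strict inequality for β is what makes the solution ε of this linear equation positive.
  obtain ⟨ε, hε, hβε⟩ : ∃ ε : ℝ, 0 < ε ∧
      1 + 1 / (α - d) + ε * (1 / (α - d) + 3 * (α - d) + 3) = β := by
    refine ⟨(β - 1 - 1 / (α - d)) / (1 / (α - d) + 3 * (α - d) + 3),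
      div_pos (by linarith) (by positivity), ?_⟩
    rw [div_mul_cancel₀ _ (by positivity)]
    ring
  have hεβ : ε < β := by
    have : 0 < ε * (1 / (α - d) + 3 * (α - d)) := by positivity
    linarith
  obtain ⟨C, hC, hE⟩ := hfield.exists_measure_exceptionalEvent_le hd hα hε hβε
  have h2 : Tendsto (fun n : ℕ => (2 : ℝ) ^ n) atTop atTop :=
    tendsto_pow_atTop_atTop_of_one_lt (by norm_num)
  have hadm := h2.eventually (ParabolicAnderson.eventually_admissibleScales hd hα hε hεβ
    (k := (1 + ε) / (α - d)) (by positivity))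
  filter_upwards [hfield.ae_one_le,
    ParabolicAnderson.ae_eventually_notMem_of_measure_le_log hε hE] with ω hω1 hω
  simp only [ParabolicAnderson.exceptionalEvent, Set.mem_union, not_or, Set.mem_ofPred_eq,
    not_forall, not_exists, not_lt, not_le, exists_prop] at hω
  refine ⟨fun t ht => ?_, ?_⟩
  -- For fixed t, one envelope at a sufficiently large scale 2^n, unrelated to t, has slope so small
  -- that tξ(z) grows at most like |z|/2. The range of Φ_t is then finite.
  · have : Nonempty (Fin d) := ⟨⟨0, hd⟩⟩
    have hlim : Tendsto (fun T : ℝ => Real.log T / T) atTop (nhds 0) :=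
      Real.isLittleO_log_id_atTop.tendsto_div_nhds_zero
    have hq : 0 < d / (α - d) := div_pos (by exact_mod_cast hd) hg0
    have hsmall := h2.eventually (hlim.eventually_le_const
      (u := 1 / (2 * (t * (d / (α - d) / 24)))) (by positivity))
    obtain ⟨n, hn, hs, hsm⟩ := (hω.and (hadm.and hsmall)).exists
    obtain ⟨⟨-, hup⟩, -⟩ := hn
    have hL := hs.log_pos
    have ha := hs.a_pos
    have hK := hs.K_pos
    generalize ParabolicAnderson.aScale d α (2 ^ n) = a at *
    generalize Real.log (2 ^ n) ^ ((1 + ε) / (α - d)) = K at *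
    refine ParabolicAnderson.exists_isTopThree (ParabolicAnderson.finite_range_Phi
      (A := t * (d / (α - d) / 24 * K * a)) fun z => ?_)
    refine (mul_lt_mul_of_pos_left (hup z) ht).trans_le ?_
    have h3 : t * (d / (α - d) / 24 * K * a *
        (1 + ParabolicAnderson.l1 z / (K * a * (2 ^ n / Real.log (2 ^ n))))) =
        t * (d / (α - d) / 24 * K * a) + ParabolicAnderson.l1 z *
          (t * (d / (α - d) / 24) * (Real.log (2 ^ n) / 2 ^ n)) := by
      field_simp
    rw [h3, div_eq_mul_one_div (ParabolicAnderson.l1 z : ℝ) 2]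
    have h4 : t * (d / (α - d) / 24) * (Real.log (2 ^ n) / 2 ^ n) ≤ 1 / 2 := by
      refine (mul_le_mul_of_nonneg_left hsm (by positivity)).trans (le_of_eq ?_)
      generalize (d : ℝ) / (α - d) = q at *
      field_simp
    gcongr
  · obtain ⟨N, hN⟩ := eventually_atTop.1 (hω.and hadm)
    filter_upwards [eventually_ge_atTop ((2 : ℝ) ^ N)] with t ht z₁ z₂ z₃ hz
    -- Each large t lies in a dyadic interval [2^n, 2^(n+1)) on which the deterministic gap estimate
    -- holds.
    obtain ⟨n, hn1, hn2⟩ := exists_nat_pow_near (x := t) (y := 2)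
      (le_trans (one_le_pow₀ (by norm_num)) ht) (by norm_num)
    have hNn : N ≤ n := by
      have : (2 : ℝ) ^ N < 2 ^ (n + 1) := ht.trans_lt hn2
      have := (pow_lt_pow_iff_right₀ (by norm_num : (1 : ℝ) < 2)).1 this
      omega
    obtain ⟨⟨⟨hlow, hup⟩, hcl⟩, hs⟩ := hN n hNn
    have hn2' : t ≤ 2 * 2 ^ n := by rw [pow_succ] at hn2; linarith
    exact (ParabolicAnderson.aScale_mul_lambdaScale_le hα (by linarith) (by positivity)
      hs.log_pos hn1 hn2').trans (hs.gap_le hω1 hlow hup hcl hn1 hn2' hz)
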